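/- Let $\mathcal H,\mathcal K$ be finite dimensional Hilbert spaces and let $\mathcal A\subseteq B(\mathcal H)$, $\mathcal B\subseteq B(\mathcal K)$ be $C^*$-algebras containing the identity operators. A density operator in $\mathcal A$ is a positive $\rho\in\mathcal A$ with $\operatorname{Tr}\rho=1$. For a linear map $T:\mathcal A\to\mathcal B$ let $T^*:\mathcal B\to\mathcal A$ be its adjoint with respect to the Hilbert-Schmidt inner products $\langle a,b\rangle=\operatorname{Tr}a^*b$. A linear map $\Phi$ is a unital Schwarz map if $\Phi(I)=I$ and $\Phi(a^*a)\ge\Phi(a)^*\Phi(a)$ for all $a$. Let $\mathcal S$ be a set of density operators in $\mathcal A$, let $T:\mathcal A\to\mathcal B$ be linear, and assume: 1. $\mathcal S$ contains an invertible element $\rho$, and $T(\rho)$ is invertible as well; 2. $T^*$ and $T_\rho:\mathcal A\to\mathcal B$, $T_\rho(b)=T(\rho)^{-1/2}\,T(\rho^{1/2}b\rho^{1/2})\,T(\rho)^{-1/2}$, are unital Schwarz maps. $T$ is called reversible for $\mathcal S$ if there is a linear map $S:\mathcal B\to\mathcal A$ such that $S^*$ is a unital Schwarz map and $S(T(\sigma))=\sigma$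 for all $\sigma\in\mathcal S$. Let $\mathrm{Lin}(\mathcal S)$ be the real linear span of $\{\sigma_1-\sigma_2:\sigma_1,\sigma_2\in\mathcal S\}$. A monotone metric assigns to every finite dimensional $C^*$-algebra of operators $\mathcal C$ a (smooth) Riemannian metric $\lambda$ on the manifold of invertible density operators in $\mathcal C$ (whose tangent space at each point consists of the traceless self-adjoint elements of $\mathcal C$), such that $\lambda_{\omega}(x,x)\ge\lambda_{\Psi(\omega)}(\Psi(x),\Psi(x))$ for every completely positive trace preserving map $\Psi:\mathcal C\to\mathcal C'$, all invertible density operators $\omega$ with $\Psi(\omega)$ invertible, and all tangent vectors $x$. For an operator monotone function $f:(0,\infty)\to(0,\infty)$ that is symmetric, i.e. $f(t)=tf(t^{-1})$, and an invertible density operator $\omega$, put $J^f_\omega=f(\Delta_\omega)R_\omega$, where $R_\omega(x)=x\omega$ and $\Delta_\omega(x)=\omega x\omega^{-1}$, and $$\lambda^f_\omega(x,y)=\operatorname{Tr}\,(J^f_\omega)^{-1}(x)\,y,\qquad \chi^2_{1/f}(\sigma,\omega)=\lambda^f_\omega(\sigma-\omega,\sigma-\omega).$$ A representing measure of $f$ is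 a positive Borel measure $\nu_f$ on $[0,\infty)$ such that, for some constant $c\ge 0$, $\;1/f(t)=c+\int_{[0,\infty)}\frac{1}{s+t}\,d\nu_f(s)$ for all $t>0$. Then the following are equivalent: (i) $T$ is reversible for $\mathcal S$. (ii) $\lambda_\rho(x,x)=\lambda_{T(\rho)}(T(x),T(x))$ for all $x\in\mathrm{Lin}(\mathcal S)$ and all monotone metrics $\lambda$. (ii') $\lambda^f_\rho(x,x)=\lambda^f_{T(\rho)}(T(x),T(x))$ for all $x\in\mathrm{Lin}(\mathcal S)$ and all symmetric operator monotone $f:(0,\infty)\to(0,\infty)$. (iii) $\chi^2_{1/f}(\sigma,\rho)=\chi^2_{1/f}(T(\sigma),T(\rho))$ for all $\sigma\in\mathcal S$ and all symmetric operator monotone $f:(0,\infty)\to(0,\infty)$. (iv) There is a symmetric operator monotone $f:(0,\infty)\to(0,\infty)$ with a representing measure whose support has at least $\dim(\mathcal H)^2+\dim(\mathcal K)^2$ points such that the equality in (ii') holds for all $x\in\mathrm{Lin}(\mathcal S)$. (v) There is a function $f$ as in (iv) such that the equality in (iii) holds for all $\sigma\in\mathcal S$. -/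

import Mathlib

open scoped Kronecker ContDiff ComplexOrder

namespace QuantumReversibility

/-- Operators on the Hilbert space `ℂⁿ`. -/
abbrev Op (n : ℕ) := Matrix (Fin n) (Fin n) ℂ

/-- C*-algebras of operators on `ℂⁿ` (containing the identity operator). -/
abbrev Alg (n : ℕ) := StarSubalgebra ℂ (Op n)

section Adjoint

variable {n m : ℕ} {A : Alg n} {B : Alg m}

/-- The Hilbert-Schmidt inner product `⟨a, b⟩ = Tr a⋆ b`. -/
def hs (a b : A) : ℂ := ((star a * b : A) : Op n).trace

lemma hs_self_eq (a : A) : hs a a = ∑ j, ∑ i, ((‖(a : Op n) i j‖ ^ 2 : ℝ) : ℂ) := by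
  simp only [hs, MulMemClass.coe_mul, StarMemClass.coe_star, Matrix.trace, Matrix.diag,
    Matrix.mul_apply, Matrix.star_apply]
  refine Finset.sum_congr rfl fun j _ => Finset.sum_congr rfl fun i _ => ?_
  rw [RCLike.star_def, Complex.conj_mul']
  push_cast
  rfl

lemma eq_zero_of_hs_self {a : A} (h : hs a a = 0) : a = 0 := by
  rw [hs_self_eq] at h
  have h' : ∑ j, ∑ i, (‖(a : Op n) i j‖ ^ 2 : ℝ) = 0 := by exact_mod_cast h
  rw [Finset.sum_eq_zero_iff_of_nonneg
    (fun j _ => Finset.sum_nonneg fun i _ => sq_nonneg _)] at h'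
  refine Subtype.ext (Matrix.ext fun i j => ?_)
  have hj := h' j (Finset.mem_univ _)
  rw [Finset.sum_eq_zero_iff_of_nonneg (fun i _ => sq_nonneg _)] at hj
  have := hj i (Finset.mem_univ _)
  simpa using this

instance : FiniteDimensional ℂ A :=
  inferInstanceAs (FiniteDimensional ℂ (Subalgebra.toSubmodule A.toSubalgebra))

lemma isClosed_alg (A : Alg n) : IsClosed (A : Set (Op n)) :=
  Submodule.closed_of_finiteDimensional (Subalgebra.toSubmodule A.toSubalgebra)

/-- Every linear functional on `A` is of the form `⟨a, ·⟩`. -/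
lemma exists_riesz (φ : A →ₗ[ℂ] ℂ) : ∃ a : A, ∀ x, hs a x = φ x := by
  let D : A →ₗ[ℂ] Module.Dual ℂ A :=
    { toFun := fun a =>
        { toFun := fun x => ((a * x : A) : Op n).trace
          map_add' := fun x y => by simp [mul_add, Matrix.trace_add]
          map_smul' := fun c x => by simp [Matrix.trace_smul] }
      map_add' := fun a b => by
        ext x
        simp [add_mul, Matrix.trace_add]
      map_smul' := fun c a => by
        ext x
        simp [Matrix.trace_smul] }
  have hD : Function.Injective D := by
    rw [injective_iff_map_eq_zero]
    intro a ha
    have h1 : D a (star a) = 0 := by rw [ha]; rfl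
    have h2 : hs (star a) (star a) = 0 := by
      simpa [hs, D] using h1
    have h3 := eq_zero_of_hs_self h2
    simpa using congrArg star h3
  have hsurj : Function.Surjective D :=
    (LinearMap.injective_iff_surjective_of_finrank_eq_finrank
      (Subspace.dual_finrank_eq (K := ℂ) (V := A)).symm).1 hD
  obtain ⟨a, ha⟩ := hsurj φ
  refine ⟨star a, fun x => ?_⟩
  rw [← ha]
  simp [hs, D]

lemma hs_left_injective {a b : A} (h : ∀ x, hs a x = hs b x) : a = b := by
  have h1 := h (a - b)
  have h2 : hs (a - b) (a - b) = 0 := by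
    have : hs (a - b) (a - b) = hs a (a - b) - hs b (a - b) := by
      simp [hs, sub_mul, Matrix.trace_sub]
    rw [this, h1, sub_self]
  exact sub_eq_zero.1 (eq_zero_of_hs_self h2)

lemma exists_hsAdjoint (T : A →ₗ[ℂ] B) :
    ∃ T' : B →ₗ[ℂ] A, ∀ b a, hs (T' b) a = hs b (T a) := by
  have key : ∀ b : B, ∃ a' : A, ∀ a, hs a' a = hs b (T a) := fun b =>
    exists_riesz
      { toFun := fun a => hs b (T a)
        map_add' := fun x y => by simp [hs, mul_add, Matrix.trace_add]
        map_smul' := fun c x => by simp [hs, Matrix.trace_smul] }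
  choose F hF using key
  refine ⟨{ toFun := F, map_add' := fun x y => ?_, map_smul' := fun c x => ?_ }, hF⟩
  · refine hs_left_injective fun a => ?_
    have : hs (F x + F y) a = hs (F x) a + hs (F y) a := by
      simp [hs, add_mul, Matrix.trace_add]
    rw [this, hF, hF, hF]
    simp [hs, add_mul, Matrix.trace_add]
  · refine hs_left_injective fun a => ?_
    have : hs (c • F x) a = star c * hs (F x) a := by
      simp [hs, Matrix.trace_smul]
    rw [RingHom.id_apply, this, hF, hF]
    simp [hs, Matrix.trace_smul]

/-- The adjoint `T⋆ : B → A` of a linear map `T : A → B` with respect to the Hilbert-Schmidt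
inner products. -/
noncomputable def hsAdjoint (T : A →ₗ[ℂ] B) : B →ₗ[ℂ] A := (exists_hsAdjoint T).choose

/-- The defining property `⟨T⋆ b, a⟩ = ⟨b, T a⟩` of the adjoint. -/
lemma hs_hsAdjoint (T : A →ₗ[ℂ] B) (b : B) (a : A) : hs (hsAdjoint T b) a = hs b (T a) :=
  (exists_hsAdjoint T).choose_spec b a

end Adjoint

section Maps

variable {n m : ℕ} {A : Alg n} {B : Alg m}

/-- Unital Schwarz maps: `Φ 1 = 1` and `Φ (a⋆ a) ≥ (Φ a)⋆ (Φ a)` for all `a`. -/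
def IsUnitalSchwarz (Φ : A →ₗ[ℂ] B) : Prop :=
  Φ 1 = 1 ∧
    ∀ a : A, ((Φ (star a * a) - star (Φ a) * Φ a : B) : Op m).PosSemidef

/-- Completely positive maps: for every `k` the map `id ⊗ Φ` on `k × k` block matrices with
entries in the algebra preserves positivity. -/
def IsCompletelyPositive (Φ : A →ₗ[ℂ] B) : Prop :=
  ∀ (k : ℕ) (a : Matrix (Fin k) (Fin k) A),
    (Matrix.comp (Fin k) (Fin k) (Fin n) (Fin n) ℂ (a.map fun x => (x : Op n))).PosSemidef →
    (Matrix.comp (Fin k) (Fin k) (Fin m) (Fin m) ℂ (a.map fun x => (Φ x : Op m))).PosSemidef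

/-- Trace preserving maps. -/
def IsTracePreserving (Φ : A →ₗ[ℂ] B) : Prop :=
  ∀ a : A, (Φ a : Op m).trace = (a : Op n).trace

/-- Density operators in `A`. -/
def IsDensity (ρ : A) : Prop := (ρ : Op n).PosSemidef ∧ (ρ : Op n).trace = 1

/-- Reversibility of `T` for a set `S` of density operators. -/
def IsReversible (T : A →ₗ[ℂ] B) (S : Set A) : Prop :=
  ∃ R : B →ₗ[ℂ] A, IsUnitalSchwarz (hsAdjoint R) ∧ ∀ σ ∈ S, R (T σ) = σ

/-- A function of an operator in `A`, by the functional calculus; it stays in `A`. -/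
noncomputable def fc (f : ℝ → ℝ) (a : A) : A :=
  ⟨cfc f (a : Op n), by
    have : IsClosed (A : Set (Op n)) := isClosed_alg A
    exact cfc_mem f a.2⟩

/-- The map `T_ρ b = T(ρ)^{-1/2} T(ρ^{1/2} b ρ^{1/2}) T(ρ)^{-1/2}`, for `ρ` and `T ρ` positive and
invertible. -/
noncomputable def petzDual (T : A →ₗ[ℂ] B) (ρ : A) : A →ₗ[ℂ] B where
  toFun b := fc (fun t => (Real.sqrt t)⁻¹) (T ρ) * T (fc Real.sqrt ρ * b * fc Real.sqrt ρ) *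
    fc (fun t => (Real.sqrt t)⁻¹) (T ρ)
  map_add' x y := by simp only [mul_add, add_mul, map_add]
  map_smul' c x := by simp only [mul_smul_comm, smul_mul_assoc, map_smul, RingHom.id_apply]

/-- `Lin(S)`, the real span of the differences of elements of `S`. -/
def Lin (S : Set A) : Submodule ℝ A :=
  Submodule.span ℝ {x | ∃ σ₁ ∈ S, ∃ σ₂ ∈ S, x = σ₁ - σ₂}

/-- The tangent space of the manifold of invertible density operators in `A`: the traceless
self-adjoint elements. -/
def IsTangent (x : A) : Prop := IsSelfAdjoint x ∧ (x : Op n).trace = 0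

end Maps

/-- A monotone metric: to each algebra `A` a Riemannian metric on the manifold of invertible
density operators in `A` is assigned, such that the metric does not increase under completely
positive trace preserving maps. The value `g n A ρ x y` is the inner product of the tangent vectors
`x` and `y` at the point `ρ`; the values for other `ρ`, `x`, `y` are irrelevant. -/
structure IsMonotoneMetric (g : ∀ (n : ℕ) (A : Alg n), A → A → A → ℝ) : Prop where
  add_left : ∀ (n : ℕ) (A : Alg n) (ρ : A), IsDensity ρ → IsUnit ρ →
    ∀ x y z : A, IsTangent x → IsTangent y → IsTangent z →
      g n A ρ (x + y) z = g n A ρ x z + g n A ρ y z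
  smul_left : ∀ (n : ℕ) (A : Alg n) (ρ : A), IsDensity ρ → IsUnit ρ →
    ∀ (c : ℝ) (x y : A), IsTangent x → IsTangent y → g n A ρ (c • x) y = c * g n A ρ x y
  symm : ∀ (n : ℕ) (A : Alg n) (ρ : A), IsDensity ρ → IsUnit ρ →
    ∀ x y : A, IsTangent x → IsTangent y → g n A ρ x y = g n A ρ y x
  pos : ∀ (n : ℕ) (A : Alg n) (ρ : A), IsDensity ρ → IsUnit ρ →
    ∀ x : A, IsTangent x → x ≠ 0 → 0 < g n A ρ x x
  smooth : ∀ (n : ℕ) (A : Alg n) (ρ : A), IsDensity ρ → IsUnit ρ →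
    ∀ x y : A, IsTangent x → IsTangent y →
    ∀ (k : ℕ) (z : Fin k → A), (∀ i, IsTangent (z i)) →
      ContDiffAt ℝ ∞ (fun u : Fin k → ℝ => g n A (ρ + ∑ i, u i • z i) x y) 0
  monotone : ∀ (n m : ℕ) (A : Alg n) (B : Alg m) (T : A →ₗ[ℂ] B),
    IsCompletelyPositive T → IsTracePreserving T →
    ∀ ρ : A, IsDensity ρ → IsUnit ρ → IsUnit (T ρ) →
    ∀ x : A, IsTangent x → g m B (T ρ) (T x) (T x) ≤ g n A ρ x x

section Functions

/-- Operator monotone functions on `(0, ∞)`: `f(a) ≤ f(b)` for all positive definite matrices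
`a ≤ b` of any size. The values of `f` outside `(0, ∞)` are irrelevant. -/
def IsOperatorMonotone (f : ℝ → ℝ) : Prop :=
  ∀ (k : ℕ) (a b : Op k), a.PosDef → b.PosDef → (b - a).PosSemidef →
    (cfc f b - cfc f a).PosSemidef

/-- Symmetric positive operator monotone functions on `(0, ∞)`. -/
structure IsSymmOperatorMonotone (f : ℝ → ℝ) : Prop where
  pos : ∀ t, 0 < t → 0 < f t
  symm : ∀ t, 0 < t → f t = t * f t⁻¹
  operatorMonotone : IsOperatorMonotone f

/-- `ν`, a positive measure on `[0, ∞)`, represents `f`: for some constant `c ≥ 0`,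
`1 / f(t) = c + ∫ (s + t)⁻¹ dν(s)` for all `t > 0`. -/
def IsRepresentingMeasure (f : ℝ → ℝ) (ν : MeasureTheory.Measure ℝ) : Prop :=
  ν (Set.Iio 0) = 0 ∧ ∃ c : ℝ, 0 ≤ c ∧ ∀ t, 0 < t →
    MeasureTheory.Integrable (fun s => (s + t)⁻¹) ν ∧ (f t)⁻¹ = c + ∫ s, (s + t)⁻¹ ∂ν

end Functions

section Metric

variable {n : ℕ}

/-- The matrix, in the standard basis of `B(ℂⁿ)`, of the modular operator
`Δ_ρ : x ↦ ρ x ρ⁻¹`. -/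
noncomputable def modular (ρ : Op n) : Matrix (Fin n × Fin n) (Fin n × Fin n) ℂ :=
  (ρ⁻¹).transpose ⊗ₖ ρ

lemma modular_mulVec (ρ x : Op n) : (modular ρ).mulVec x.vec = (ρ * x * ρ⁻¹).vec := by
  rw [modular, Matrix.kronecker_mulVec_vec, Matrix.transpose_transpose]

/-- The matrix of the operator `R_ρ : x ↦ x ρ`. -/
noncomputable def rightMul (ρ : Op n) : Matrix (Fin n × Fin n) (Fin n × Fin n) ℂ :=
  ρ.transpose ⊗ₖ (1 : Op n)

lemma rightMul_mulVec (ρ x : Op n) : (rightMul ρ).mulVec x.vec = (x * ρ).vec := by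
  rw [rightMul, Matrix.kronecker_mulVec_vec, Matrix.transpose_transpose, one_mul]

/-- The matrix of the operator `J = f(Δ_ρ) R_ρ`. -/
noncomputable def J (f : ℝ → ℝ) (ρ : Op n) : Matrix (Fin n × Fin n) (Fin n × Fin n) ℂ :=
  cfc f (modular ρ) * rightMul ρ

/-- The operator `J⁻¹`. -/
noncomputable def JInv (f : ℝ → ℝ) (ρ x : Op n) : Op n :=
  Matrix.of fun i j => ((J f ρ)⁻¹.mulVec x.vec) (j, i)

/-- The metric `λ_ρ(x, y) = Tr J⁻¹(x) y` given by the function `f`. If `ρ` belongs to an algebra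
`A`, then `A` is an invariant subspace of `Δ_ρ`, `R_ρ` and `J`, so that for `x`, `y` in `A` this is
the same for the operators on `A` as for the operators on `B(ℂⁿ)`. -/
noncomputable def metric (f : ℝ → ℝ) (ρ x y : Op n) : ℂ := (JInv f ρ x * y).trace

/-- The quantum `χ²`-divergence of `σ` and `ρ` given by the function `f`. -/
noncomputable def chiSq (f : ℝ → ℝ) (σ ρ : Op n) : ℂ := metric f ρ (σ - ρ) (σ - ρ)

end Metric

end QuantumReversibility

open QuantumReversibility

/-! Put τ = T(ρ). For f(t) = s + t the operator J is a ↦ s aρ + ρa, and the metric at a self-adjoint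
x is ⟨a, x⟩, where s aρ + ρa = x. Let b solve the same equation for τ and T(x). Completing the
square (`hs_mulSum_sub`) writes ⟨a, x⟩ − ⟨b, T(x)⟩ as the quadratic form of J at a − T⋆b plus
weighted ρ-expectations of the Schwarz defects of T⋆ at b and b⋆. All terms are nonnegative.
Equality therefore forces T⋆b = a and, when s > 0, puts b in the multiplicative domain of T⋆.

From (v) to (i): 1/f is a constant plus an integral of the functions 1/(s+t), so equality for f
gives equality at every s in the support of the measure (`metric_eq_of_mem_support`). The pair (b,
a) is the resolvent of Δ_τ ⊕ Δ_ρ at −s, applied to (T(x)τ⁻¹, xρ⁻¹). This operator acts on B × A, of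
dimension at most n² + m², so the span of that many resolvents contains the whole cyclic subspace of
the vector (`aeval_mem_of_resolvent_mem`). The graph of T⋆ then contains the resolvents for all s >
0, and the metrics agree for all s > 0 (`metric_eq_of_finset`). The same spanning argument, with
multiplicative pairs in place of the graph, covers all modular translates of (T(x)τ⁻¹, xρ⁻¹). The
pairs whose translates are all multiplicative form a modular invariant star algebra G in B × A on
which the states τ and ρ agree. As in Takesaki's theorem, the τ-orthogonal projection of B onto G
followed by the second coordinate is unital and completely positive, and its adjoint maps aρ to bτ
for (b, a) in G (`exists_channel`). Exchanging the factors gives a channel R with R(τ) = ρ and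
R(T(x)) = x, which is the recovery map (`exists_channels`).

Conversely, if T is reversible, monotonicity under T and under its inverse gives equality for all s
+ t with s > 0. This yields (ii'), because the modular operators have finite spectrum and on a
finite set 1/f is a combination of functions 1/(s+t). For (ii), T need not be completely positive,
so an abstract monotone metric is compared along the channels of `exists_channels`. Finally, the
metrics of s + t are themselves monotone metrics, so (ii) implies (i), and √t serves as the function
in (iv) and (v). -/

namespace QuantumReversibility

/-! ### Partial fractions, and cyclic subspaces spanned by resolvents. -/

section PartialFractions

open Polynomial Lagrange

variable {K : Type*} [Field K] [DecidableEq K]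

/-- Lagrange interpolation at the nodes `s`, with the denominators of the basis polynomials absorbed
into the coefficients. Divided by the nodal polynomial, this is the partial fraction decomposition
with simple poles. -/
lemma exists_eq_sum_nodal_erase (s : Finset K) (r : K[X]) (h : r.degree < s.card) :
    ∃ c : K → K, r = ∑ z ∈ s, C (c z) * nodal (s.erase z) id := by
  refine ⟨fun z => r.eval z * ∏ w ∈ s.erase z, (z - w)⁻¹, ?_⟩
  conv_lhs => rw [eq_interpolate (v := id) (Function.injective_id.injOn) h, interpolate_apply]
  refine Finset.sum_congr rfl fun z _ => ?_
  rw [Lagrange.basis, C_mul, mul_assoc, map_prod, nodal_eq, ← Finset.prod_mul_distrib]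
  rfl

lemma aeval_nodal_injective {V : Type*} [AddCommGroup V] [Module K V] (D : Module.End K V)
    (s : Finset K) (h : ∀ z ∈ s, Function.Injective fun v => D v - z • v) :
    Function.Injective (aeval D (nodal s id)) := by
  induction s using Finset.induction_on with
  | empty =>
    rw [nodal_empty, map_one]
    exact Function.injective_id
  | insert a s ha ih =>
    rw [nodal_insert_eq_nodal ha, map_mul, Module.End.mul_eq_comp, LinearMap.coe_comp]
    refine Function.Injective.comp ?_ (ih fun z hz => h z (Finset.mem_insert_of_mem hz))
    have := h a (Finset.mem_insert_self _ _)
    convert this using 1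
    ext v
    simp [Module.algebraMap_end_apply]

/-- A subspace that contains sufficiently many resolvents of `D` at `y` contains the cyclic
subspace generated by `y`. -/
lemma aeval_mem_of_resolvent_mem {V : Type*} [AddCommGroup V] [Module K V] [FiniteDimensional K V]
    (D : Module.End K V) (W : Submodule K V) (y : V) (s : Finset K)
    (hs : Module.finrank K V ≤ s.card) (hinj : ∀ z ∈ s, Function.Injective fun v => D v - z • v)
    (hw : ∀ z ∈ s, ∃ w ∈ W, D w - z • w = y) (p : K[X]) : aeval D p y ∈ W := by
  choose! w hwW hwy using hw
  set N := nodal s id with hN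
  -- By Cayley–Hamilton `r` and `p * N` agree at `D`, and the remainder has degree below the number
  -- of nodes, as partial fractions require. The injective factor `N` is cancelled at the end.
  set r := (p * N) %ₘ D.charpoly with hr
  have hdeg : r.degree < s.card := by
    refine (degree_modByMonic_lt _ D.charpoly_monic).trans_le ?_
    rw [degree_eq_natDegree D.charpoly_monic.ne_zero, LinearMap.charpoly_natDegree]
    exact_mod_cast hs
  have haeval : aeval D r = aeval D (p * N) := by
    have := congrArg (aeval D) (modByMonic_add_div (p * N) D.charpoly)
    simpa [LinearMap.aeval_self_charpoly] using this
  obtain ⟨c, hc⟩ := exists_eq_sum_nodal_erase s r hdeg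
  have key : aeval D N (aeval D p y) = aeval D N (∑ z ∈ s, c z • w z) := by
    have h1 : aeval D N (aeval D p y) = aeval D r y := by
      rw [haeval, mul_comm, map_mul, Module.End.mul_apply]
    rw [h1, hc, map_sum, LinearMap.sum_apply, map_sum]
    refine Finset.sum_congr rfl fun z hz => ?_
    rw [hN, nodal_eq_mul_nodal_erase hz, map_mul, aeval_C, mul_comm (X - C (id z)), map_mul,
      Module.End.mul_apply, Module.End.mul_apply, Module.algebraMap_end_apply]
    conv_lhs => rw [← hwy z hz]
    simp [Module.algebraMap_end_apply, smul_sub]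
  rw [aeval_nodal_injective D s hinj key]
  exact W.sum_mem fun z hz => W.smul_mem _ (hwW z hz)

/-- On a finite subset of `(0, ∞)` every function is a combination of the functions
`t ↦ (s + t)⁻¹` with `s > 0`. -/
lemma exists_eq_sum_inv_add (Λ : Finset ℝ) (hΛ : ∀ t ∈ Λ, 0 < t) (h : ℝ → ℝ) :
    ∃ (s : Finset ℝ) (c : ℝ → ℝ), (∀ z ∈ s, 0 < z) ∧ ∀ t ∈ Λ, h t = ∑ z ∈ s, c z * (z + t)⁻¹ := by
  -- As many negative poles as points of `Λ`: interpolating `h` times the nodal polynomial on `Λ`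
  -- then gives a degree small enough for partial fractions.
  let s : Finset ℝ := (Finset.range Λ.card).image fun k : ℕ => -((k : ℝ) + 1)
  have hs : s.card = Λ.card := by
    rw [Finset.card_image_of_injective, Finset.card_range]
    intro a b hab
    simpa using hab
  have hsneg : ∀ z ∈ s, z < 0 := by
    intro z hz
    obtain ⟨k, -, rfl⟩ := Finset.mem_image.1 hz
    have : (0 : ℝ) ≤ k := k.cast_nonneg
    linarith
  let g : ℝ → ℝ := fun t => h t * (nodal s id).eval t
  have hdeg : (interpolate Λ id g).degree < s.card := by
    rw [hs]
    exact degree_interpolate_lt _ Function.injective_id.injOn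
  obtain ⟨c, hc⟩ := exists_eq_sum_nodal_erase s _ hdeg
  refine ⟨s.image Neg.neg, fun z => c (-z), ?_, fun t ht => ?_⟩
  · intro z hz
    obtain ⟨w, hw, rfl⟩ := Finset.mem_image.1 hz
    have := hsneg w hw
    linarith
  · have h1 : g t = ∑ z ∈ s, c z * (nodal (s.erase z) id).eval t := by
      have h2 := eval_interpolate_at_node (r := g) (v := id) (Function.injective_id.injOn) ht
      rw [hc] at h2
      simpa [eval_finsetSum] using h2.symm
    have hne : (nodal s id).eval t ≠ 0 := by
      rw [eval_nodal, Finset.prod_ne_zero_iff]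
      intro z hz
      have := hsneg z hz
      have := hΛ t ht
      simp only [id]
      linarith
    rw [Finset.sum_image neg_injective.injOn]
    rw [← mul_left_inj' hne, Finset.sum_mul]
    refine h1.trans (Finset.sum_congr rfl fun z hz => ?_)
    have hz' : -z + t ≠ 0 := by
      have := hsneg z hz
      have := hΛ t ht
      linarith
    rw [nodal_eq_mul_nodal_erase hz, eval_mul, eval_sub, eval_X, eval_C]
    simp only [id, neg_neg]
    have hz'' : t - z = -z + t := by ring
    rw [hz'']
    field_simp

/-- Both sums see `g` only on the finite set of their atoms, where `g` is a combination of resolvent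
functions. -/
lemma sum_mul_eq_of_sum_mul_inv_add_eq {ι κ : Type} [Fintype ι] [Fintype κ] (u : ι → ℝ)
    (v : κ → ℝ) (hu : ∀ i, 0 < u i) (hv : ∀ j, 0 < v j) (μ : ι → ℂ) (ν : κ → ℂ)
    (h : ∀ s : ℝ, 0 < s → ∑ i, μ i * (((s + u i)⁻¹ : ℝ) : ℂ) = ∑ j, ν j * (((s + v j)⁻¹ : ℝ) : ℂ))
    (g : ℝ → ℝ) : ∑ i, μ i * (g (u i) : ℂ) = ∑ j, ν j * (g (v j) : ℂ) := by
  classical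
  obtain ⟨s, c, hs, hc⟩ := exists_eq_sum_inv_add
    (Finset.univ.image u ∪ Finset.univ.image v) (by
      intro t ht
      rcases Finset.mem_union.1 ht with ht | ht <;> obtain ⟨i, -, rfl⟩ := Finset.mem_image.1 ht
      exacts [hu i, hv i]) g
  have hcu : ∀ i, g (u i) = ∑ z ∈ s, c z * (z + u i)⁻¹ := fun i =>
    hc _ (Finset.mem_union_left _ (Finset.mem_image_of_mem _ (Finset.mem_univ _)))
  have hcv : ∀ i, g (v i) = ∑ z ∈ s, c z * (z + v i)⁻¹ := fun i =>
    hc _ (Finset.mem_union_right _ (Finset.mem_image_of_mem _ (Finset.mem_univ _)))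
  have expand : ∀ {τ : Type} [Fintype τ] (w : τ → ℝ) (α : τ → ℂ)
      (_ : ∀ i, g (w i) = ∑ z ∈ s, c z * (z + w i)⁻¹),
      ∑ i, α i * (g (w i) : ℂ) = ∑ z ∈ s, (c z : ℂ) * ∑ i, α i * (((z + w i)⁻¹ : ℝ) : ℂ) := by
    intro τ _ w α hw
    simp only [hw, Complex.ofReal_sum, Complex.ofReal_mul, Finset.mul_sum]
    rw [Finset.sum_comm]
    exact Finset.sum_congr rfl fun _ _ => Finset.sum_congr rfl fun _ _ => by ring
  rw [expand u μ hcu, expand v ν hcv]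
  exact Finset.sum_congr rfl fun z hz => by rw [h z (hs z hz)]

end PartialFractions

/-! ### Positivity tested against a faithful state. -/

section Positivity

open Matrix

variable {ι : Type*} [Fintype ι] [DecidableEq ι]

lemma exists_eq_star_mul_self {P : Matrix ι ι ℂ} (hP : P.PosSemidef) :
    ∃ C : Matrix ι ι ℂ, P = Cᴴ * C := by
  open scoped MatrixOrder in
  exact CStarAlgebra.nonneg_iff_eq_star_mul_self.mp hP.nonneg

lemma trace_mul_nonneg {P Q : Matrix ι ι ℂ} (hP : P.PosSemidef) (hQ : Q.PosSemidef) :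
    0 ≤ (P * Q).trace := by
  obtain ⟨C, rfl⟩ := exists_eq_star_mul_self hQ
  rw [← mul_assoc, trace_mul_comm, ← mul_assoc]
  exact (hP.mul_mul_conjTranspose_same C).trace_nonneg

lemma eq_zero_of_trace_mul_eq_zero {W P : Matrix ι ι ℂ} (hW : W.PosDef) (hP : P.PosSemidef)
    (h : (W * P).trace = 0) : P = 0 := by
  obtain ⟨C, rfl⟩ := exists_eq_star_mul_self hP
  obtain ⟨B, hB⟩ := exists_eq_star_mul_self hW.posSemidef
  rw [← mul_assoc, trace_mul_comm, ← mul_assoc, hB, ← mul_assoc, mul_assoc] at h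
  have h1 : (B * Cᴴ)ᴴ * (B * Cᴴ) = C * Bᴴ * (B * Cᴴ) := by simp
  rw [← h1, trace_conjTranspose_mul_self_eq_zero_iff] at h
  have hu : IsUnit B := by
    have := hW.isUnit
    rw [hB] at this
    rw [isUnit_iff_isUnit_det] at this ⊢
    rw [det_mul] at this
    exact isUnit_of_mul_isUnit_right this
  have h2 : Cᴴ = 0 := hu.mul_right_eq_zero.1 h
  rw [h2, zero_mul]

/-- Positivity of an element of an operator algebra can be tested, in a faithful state, on the
algebra itself. -/
lemma posSemidef_of_trace_nonneg (C : StarSubalgebra ℂ (Matrix ι ι ℂ)) {W X : Matrix ι ι ℂ}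
    (hW : W.PosDef) (hX : X ∈ C) (h : ∀ d ∈ C, 0 ≤ (W * (dᴴ * X * d)).trace) :
    X.PosSemidef := by
  have hWs : Wᴴ = W := hW.isHermitian
  set v := X - Xᴴ with hv
  have hvC : v ∈ C := sub_mem hX (star_mem hX)
  have hdiag : ∀ d ∈ C, (W * (dᴴ * v * d)).trace = 0 := by
    intro d hd
    have h1 := h d hd
    have h2 : (W * (dᴴ * Xᴴ * d)).trace = star (W * (dᴴ * X * d)).trace := by
      rw [← trace_conjTranspose]
      simp only [conjTranspose_mul, conjTranspose_conjTranspose, hWs]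
      rw [trace_mul_comm]
      simp only [mul_assoc]
    have h3 : star (W * (dᴴ * X * d)).trace = (W * (dᴴ * X * d)).trace :=
      (IsSelfAdjoint.of_nonneg h1).star_eq
    rw [hv, mul_sub, sub_mul, mul_sub, trace_sub, h2, h3, sub_self]
  have hv0 : v = 0 := by
    -- Polarisation inside the algebra: `v + 1` gives Tr W v⋆v + Tr W v² = 0 and `v + i` gives Tr W
    -- v⋆v − Tr W v² = 0.
    have e1 := hdiag (v + 1) (add_mem hvC (one_mem C))
    have e2 := hdiag (v + Complex.I • 1) (add_mem hvC (C.smul_mem (one_mem C) _))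
    have e3 := hdiag v hvC
    have e4 := hdiag 1 (one_mem C)
    simp only [conjTranspose_add, conjTranspose_one, conjTranspose_smul, add_mul, mul_add, mul_one,
      one_mul, trace_add, e3, smul_mul_assoc, mul_smul_comm, trace_smul, smul_eq_mul,
      RCLike.star_def, Complex.conj_I] at e1 e2
    simp only [conjTranspose_one, mul_one, one_mul] at e4
    have e5 : (W * (vᴴ * v)).trace = 0 := by
      rw [e4] at e1 e2
      have h6 : (W * (v * v)).trace = - (W * (vᴴ * v)).trace := by linear_combination e1
      rw [h6] at e2
      have : (2 * Complex.I) * (W * (vᴴ * v)).trace = 0 := by linear_combination e2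
      simpa using this
    have := eq_zero_of_trace_mul_eq_zero hW (posSemidef_conjTranspose_mul_self v) e5
    exact conjTranspose_mul_self_eq_zero.1 this
  have hXs : X.IsHermitian := (sub_eq_zero.1 hv0).symm
  have hXsa : IsSelfAdjoint X := hXs
  -- Test with the negative part of `X`, which stays in the algebra: −d⋆Xd is positive, while the
  -- hypothesis makes its expectation nonpositive.
  let d : Matrix ι ι ℂ := cfc (fun t : ℝ => max (-t) 0) X
  have hdC : d ∈ C := by
    have : IsClosed (C : Set (Matrix ι ι ℂ)) :=
      Submodule.closed_of_finiteDimensional (Subalgebra.toSubmodule C.toSubalgebra)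
    exact cfc_mem _ hX
  have hds : dᴴ = d := (cfc_predicate (fun t : ℝ => max (-t) 0) X : IsSelfAdjoint d)
  have hfin : ∀ f : ℝ → ℝ, ContinuousOn f (spectrum ℝ X) := fun f =>
    (Matrix.finite_real_spectrum (A := X)).continuousOn f
  have hdXd : dᴴ * X * d = cfc (fun t : ℝ => max (-t) 0 * t * max (-t) 0) X := by
    rw [hds]
    conv_lhs => rw [show X = cfc (fun t : ℝ => t) X from (cfc_id' ℝ X).symm]
    simp only [d]
    rw [← cfc_mul _ _ X (hfin _) (hfin _), ← cfc_mul _ _ X (hfin _) (hfin _)]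
  have hneg : (-(dᴴ * X * d)).PosSemidef := by
    open scoped MatrixOrder in
    rw [← nonneg_iff_posSemidef, hdXd, ← cfc_neg]
    refine cfc_nonneg fun t _ => ?_
    rcases le_total t 0 with ht | ht
    · rw [max_eq_left (by linarith)]
      have : 0 ≤ (-t) * (t * t) := mul_nonneg (by linarith) (mul_self_nonneg t)
      nlinarith
    · rw [max_eq_right (by linarith)]
      simp
  have hz : (W * (-(dᴴ * X * d))).trace = 0 := by
    refine le_antisymm ?_ (trace_mul_nonneg hW.posSemidef hneg)
    rw [mul_neg, trace_neg, neg_nonpos]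
    exact h d hdC
  have h0 : cfc (fun t : ℝ => max (-t) 0 * t * max (-t) 0) X = 0 := by
    rw [← hdXd]
    exact neg_eq_zero.1 (eq_zero_of_trace_mul_eq_zero hW hneg hz)
  have hspec : ∀ t ∈ spectrum ℝ X, 0 ≤ t := by
    intro t ht
    have h1 : max (-t) 0 * t * max (-t) 0 = 0 :=
      eqOn_of_cfc_eq_cfc (h0.trans (cfc_const_zero ℝ X).symm) (hfin _) (hfin _) hXsa ht
    by_contra hneg
    rw [max_eq_left (by linarith)] at h1
    have : t = 0 := by simpa using h1
    linarith
  rw [hXs.posSemidef_iff_eigenvalues_nonneg]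
  exact fun i => hspec _ (hXs.eigenvalues_mem_spectrum_real i)

end Positivity
-- Trace and Hilbert–Schmidt pairing on an operator algebra.
section HilbertSchmidt

variable {n m : ℕ} {A : Alg n} {B : Alg m}

/-- The trace of `B(ℂⁿ)` as a functional on `A`. -/
noncomputable def tr : A →ₗ[ℂ] ℂ where
  toFun a := (a : Op n).trace
  map_add' a b := by simp [Matrix.trace_add]
  map_smul' c a := by simp [Matrix.trace_smul]

lemma tr_apply (a : A) : tr a = (a : Op n).trace := rfl

lemma tr_mul_comm (a b : A) : tr (a * b) = tr (b * a) :=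
  Matrix.trace_mul_comm (a : Op n) (b : Op n)

lemma tr_star (a : A) : tr (star a) = star (tr a) :=
  Matrix.trace_conjTranspose (a : Op n)

lemma hs_eq_tr (a b : A) : hs a b = tr (star a * b) := rfl

lemma star_hs (a b : A) : star (hs a b) = hs b a := by
  rw [hs_eq_tr, hs_eq_tr, ← tr_star, star_mul, star_star]

lemma hs_star_right (a b : A) : hs a (star b) = hs b (star a) := tr_mul_comm _ _

lemma hs_sub_right (a b c : A) : hs a (b - c) = hs a b - hs a c := by
  simp only [hs_eq_tr, mul_sub, map_sub]

lemma hs_sub_left (a b c : A) : hs (a - b) c = hs a c - hs b c := by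
  simp only [hs_eq_tr, star_sub, sub_mul, map_sub]

lemma hs_right_injective {a b : A} (h : ∀ x, hs x a = hs x b) : a = b :=
  hs_left_injective fun x => by rw [← star_hs x a, ← star_hs x b, h]

lemma hs_hsAdjoint_right (T : A →ₗ[ℂ] B) (b : B) (a : A) : hs a (hsAdjoint T b) = hs (T a) b := by
  rw [← star_hs, hs_hsAdjoint, star_hs]

lemma tr_mul_nonneg {a b : A} (ha : (a : Op n).PosSemidef) (hb : (b : Op n).PosSemidef) :
    0 ≤ tr (a * b) := trace_mul_nonneg ha hb

lemma eq_zero_of_tr_mul_eq_zero {ρ a : A} (hρ : (ρ : Op n).PosDef) (ha : (a : Op n).PosSemidef)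
    (h : tr (ρ * a) = 0) : a = 0 :=
  Subtype.ext (eq_zero_of_trace_mul_eq_zero hρ ha h)

lemma posSemidef_star_mul_self (a : A) : ((star a * a : A) : Op n).PosSemidef :=
  Matrix.posSemidef_conjTranspose_mul_self _

lemma star_eq_of_posSemidef {a : A} (ha : (a : Op n).PosSemidef) : star a = a :=
  Subtype.ext ha.isHermitian

lemma eq_zero_of_star_mul_self {a : A} (h : star a * a = 0) : a = 0 :=
  Subtype.ext (Matrix.conjTranspose_mul_self_eq_zero.1 (congrArg Subtype.val h))

lemma posDef_of_isUnit {ρ : A} (h : (ρ : Op n).PosSemidef) (hu : IsUnit ρ) :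
    (ρ : Op n).PosDef :=
  h.posDef_iff_isUnit.2 (hu.map A.subtype)

lemma isUnit_of_posDef {ρ : A} (h : (ρ : Op n).PosDef) : IsUnit ρ := by
  have hinj : Function.Injective (LinearMap.mulLeft ℂ ρ) := by
    rw [injective_iff_map_eq_zero]
    intro a ha
    have h1 : (ρ : Op n) * a = 0 := congrArg Subtype.val ha
    exact Subtype.ext (h.isUnit.mul_right_eq_zero.1 h1)
  obtain ⟨b, hb⟩ := LinearMap.injective_iff_surjective.1 hinj 1
  have hb' : ρ * b = 1 := hb
  refine ⟨⟨ρ, b, hb', ?_⟩, rfl⟩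
  exact Subtype.ext (mul_eq_one_comm.1 (congrArg Subtype.val hb'))

end HilbertSchmidt

/-! ### The quadratic form of b ↦ r bρ + s ρb. -/

section QuadraticForm

variable {n m : ℕ} {A : Alg n} {B : Alg m}

/-- The operator `b ↦ r b ρ + s ρ b` on `A`. -/
noncomputable def mulSum (r s : ℝ) (ρ : A) : A →ₗ[ℂ] A :=
  (r : ℂ) • LinearMap.mulRight ℂ ρ + (s : ℂ) • LinearMap.mulLeft ℂ ρ

lemma mulSum_apply (r s : ℝ) (ρ b : A) :
    mulSum r s ρ b = (r : ℂ) • (b * ρ) + (s : ℂ) • (ρ * b) := rfl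

lemma hs_mulSum_self (r s : ℝ) (ρ b : A) :
    hs b (mulSum r s ρ b) = r * tr (ρ * (star b * b)) + s * tr (ρ * (b * star b)) := by
  rw [hs_eq_tr, mulSum_apply, mul_add, mul_smul_comm, mul_smul_comm, map_add, map_smul, map_smul,
    ← mul_assoc, tr_mul_comm, tr_mul_comm (star b), mul_assoc, smul_eq_mul, smul_eq_mul]

lemma hs_mulSum_left (r s : ℝ) {ρ : A} (hρ : star ρ = ρ) (a b : A) :
    hs (mulSum r s ρ a) b = hs a (mulSum r s ρ b) := by
  simp only [hs_eq_tr, mulSum_apply, star_add, star_smul, star_mul, hρ, add_mul, mul_add,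
    mul_smul_comm, smul_mul_assoc, map_add, map_smul, RCLike.star_def, Complex.conj_ofReal]
  rw [← mul_assoc (star a) b ρ, tr_mul_comm (star a * b) ρ, mul_assoc, mul_assoc]

lemma hs_mulSum_self_nonneg {r s : ℝ} (hr : 0 ≤ r) (hs' : 0 ≤ s) {ρ : A}
    (hρ : (ρ : Op n).PosSemidef) (b : A) : 0 ≤ hs b (mulSum r s ρ b) := by
  rw [hs_mulSum_self]
  have h1 := tr_mul_nonneg hρ (posSemidef_star_mul_self b)
  have h2 := tr_mul_nonneg hρ (posSemidef_star_mul_self (star b))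
  rw [star_star] at h2
  have hr' : (0 : ℂ) ≤ r := by exact_mod_cast hr
  have hs'' : (0 : ℂ) ≤ s := by exact_mod_cast hs'
  positivity

lemma tr_eq_zero_of_hs_mulSum_self_eq_zero {r s : ℝ} (hr : 0 ≤ r) (hs' : 0 ≤ s) {ρ x y : A}
    (hρ : (ρ : Op n).PosSemidef) (hx : (x : Op n).PosSemidef) (hy : (y : Op n).PosSemidef)
    (h : r * tr (ρ * x) + s * tr (ρ * y) = 0) :
    r * tr (ρ * x) = 0 ∧ s * tr (ρ * y) = 0 := by
  have h1 := tr_mul_nonneg hρ hx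
  have h2 := tr_mul_nonneg hρ hy
  have hr' : (0 : ℂ) ≤ r := by exact_mod_cast hr
  have hs'' : (0 : ℂ) ≤ s := by exact_mod_cast hs'
  exact (add_eq_zero_iff_of_nonneg (mul_nonneg hr' h1) (mul_nonneg hs'' h2)).1 h

lemma eq_zero_of_hs_mulSum_self {r s : ℝ} (hr : 0 ≤ r) (hs' : 0 ≤ s) (hrs : 0 < r ∨ 0 < s) {ρ : A}
    (hρ : (ρ : Op n).PosDef) {b : A} (h : hs b (mulSum r s ρ b) = 0) : b = 0 := by
  rw [hs_mulSum_self] at h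
  have hp2 := posSemidef_star_mul_self (star b)
  rw [star_star] at hp2
  obtain ⟨h1, h2⟩ := tr_eq_zero_of_hs_mulSum_self_eq_zero hr hs' hρ.posSemidef
    (posSemidef_star_mul_self b) hp2 h
  rcases hrs with h0 | h0
  · have : tr (ρ * (star b * b)) = 0 := by
      rcases mul_eq_zero.1 h1 with h' | h'
      · exact absurd (by exact_mod_cast h') h0.ne'
      · exact h'
    exact eq_zero_of_star_mul_self (eq_zero_of_tr_mul_eq_zero hρ (posSemidef_star_mul_self b) this)
  · have : tr (ρ * (b * star b)) = 0 := by
      rcases mul_eq_zero.1 h2 with h' | h'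
      · exact absurd (by exact_mod_cast h') h0.ne'
      · exact h'
    have h3 := eq_zero_of_tr_mul_eq_zero hρ hp2 this
    have h4 : star b = 0 := eq_zero_of_star_mul_self (by rw [star_star]; exact h3)
    simpa using h4

lemma mulSum_injective {r s : ℝ} (hr : 0 ≤ r) (hs' : 0 ≤ s) (hrs : 0 < r ∨ 0 < s) {ρ : A}
    (hρ : (ρ : Op n).PosDef) : Function.Injective (mulSum r s ρ) := by
  rw [injective_iff_map_eq_zero]
  intro b hb
  refine eq_zero_of_hs_mulSum_self hr hs' hrs hρ ?_
  rw [hb]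
  simp [hs]

lemma mulSum_surjective {r s : ℝ} (hr : 0 ≤ r) (hs' : 0 ≤ s) (hrs : 0 < r ∨ 0 < s) {ρ : A}
    (hρ : (ρ : Op n).PosDef) : Function.Surjective (mulSum r s ρ) :=
  LinearMap.injective_iff_surjective.1 (mulSum_injective hr hs' hrs hρ)

end QuadraticForm

/-! ### Unital Schwarz maps and their multiplicative domains. -/

section Schwarz

lemma eq_zero_of_forall_nonneg {α ξ : ℂ} (h : ∀ z : ℂ, 0 ≤ α + z * ξ + star z * star ξ) :
    ξ = 0 := by
  by_contra hξ
  have hpos : 0 < Complex.normSq ξ := Complex.normSq_pos.2 hξ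
  -- With this `k`, the choice z = −k ξ̄ gives real part −Re α − 2, while z = 0 gives Re α ≥ 0.
  obtain ⟨k, hk⟩ : ∃ k : ℝ, k * Complex.normSq ξ = α.re + 1 :=
    ⟨(α.re + 1) / Complex.normSq ξ, div_mul_cancel₀ _ hpos.ne'⟩
  have h1 := (Complex.nonneg_iff.1 (h (-(k : ℂ) * star ξ))).1
  have h2 : (α + -(k : ℂ) * star ξ * ξ + star (-(k : ℂ) * star ξ) * star ξ).re
      = α.re - 2 * (k * Complex.normSq ξ) := by
    simp [Complex.normSq_apply]
    ring
  rw [h2, hk] at h1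
  have h4 := (Complex.nonneg_iff.1 (h 0)).1
  simp at h4
  linarith

variable {n m : ℕ} {A : Alg n} {B : Alg m} {Φ : A →ₗ[ℂ] B}

lemma IsUnitalSchwarz.star_map_star_mul_self (h : IsUnitalSchwarz Φ) (a : A) :
    star (Φ (star a * a)) = Φ (star a * a) := by
  have h1 := star_eq_of_posSemidef (h.2 a)
  simpa using h1

/-- The Schwarz inequality makes Φ(a⋆a) self-adjoint, and for self-adjoint x one has 2x = (x + 1)² −
x² − 1. The general case splits into real and imaginary parts. -/
lemma IsUnitalSchwarz.map_star (h : IsUnitalSchwarz Φ) (a : A) : Φ (star a) = star (Φ a) := by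
  have key : ∀ x : A, IsSelfAdjoint x → star (Φ x) = Φ x := by
    intro x hx
    have h1 := h.star_map_star_mul_self (x + 1)
    have h2 := h.star_map_star_mul_self x
    rw [star_add, hx.star_eq, star_one, add_mul, mul_add, mul_one, one_mul] at h1
    rw [hx.star_eq] at h2
    simp only [map_add, h.1, star_add, h2, star_one] at h1
    have h3 : (2 : ℂ) • star (Φ x) = (2 : ℂ) • Φ x := by
      rw [two_smul, two_smul]
      have h4 := congrArg (fun z => z - Φ (x * x) - 1) h1
      convert h4 using 1 <;> abel
    exact smul_right_injective _ (two_ne_zero' ℂ) h3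
  have ha := realPart_add_I_smul_imaginaryPart a
  have h1 := key _ (realPart a).2
  have h2 := key _ (imaginaryPart a).2
  conv_lhs => rw [← ha]
  conv_rhs => rw [← ha]
  simp only [star_add, star_smul, map_add, map_smul, h1, h2, (realPart a).2.star_eq,
    (imaginaryPart a).2.star_eq]

lemma IsUnitalSchwarz.posSemidef_map (h : IsUnitalSchwarz Φ) (a : A) :
    ((Φ (star a * a) : B) : Op m).PosSemidef := by
  have := (h.2 a).add (posSemidef_star_mul_self (Φ a))
  simpa using this

lemma eq_zero_of_forall_tr_mul {X : A}
    (h : ∀ p : A, (p : Op n).PosSemidef → tr (p * X) = 0) : X = 0 := by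
  have hpos : (X : Op n).PosSemidef := by
    refine posSemidef_of_trace_nonneg A Matrix.PosDef.one X.2 fun d hd => ?_
    let d' : A := ⟨d, hd⟩
    have h1 := h (star (star d') * star d') (posSemidef_star_mul_self (star d'))
    rw [star_star] at h1
    rw [one_mul, Matrix.trace_mul_comm, ← mul_assoc]
    exact h1.ge
  exact eq_zero_of_tr_mul_eq_zero (ρ := (1 : A)) Matrix.PosDef.one hpos
    (h 1 Matrix.PosSemidef.one)

/-- If the Schwarz inequality is an equality at `b`, then `b` is in the multiplicative domain. -/
lemma IsUnitalSchwarz.map_mul_of_eq (h : IsUnitalSchwarz Φ) {b : A}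
    (hb : Φ (star b * b) = star (Φ b) * Φ b) (c : A) : Φ (star c * b) = star (Φ c) * Φ b := by
  -- The Schwarz defect is a positive operator-valued sesquilinear form; a vector of length zero is
  -- orthogonal to everything, as in the Cauchy–Schwarz inequality.
  let D : A → A → B := fun x y => Φ (star x * y) - star (Φ x) * Φ y
  have hD : ∀ x, ((D x x : B) : Op m).PosSemidef := h.2
  have hDb : D b b = 0 := sub_eq_zero.2 hb
  have expand : ∀ z : ℂ, D (c + z • b) (c + z • b) = D c c + z • D c b + star z • D b c := by
    intro z
    have : D (c + z • b) (c + z • b) = D c c + z • D c b + star z • D b c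
        + (star z * z) • D b b := by
      simp only [D, star_add, star_smul, map_add, map_smul, add_mul, mul_add, smul_mul_assoc,
        mul_smul_comm, smul_smul, smul_sub, smul_add, mul_comm (star z) z]
      abel
    rw [this, hDb, smul_zero, add_zero]
  have hDstar : D b c = star (D c b) := by
    simp only [D, star_sub, ← h.map_star, star_mul, star_star]
  have htr : ∀ p : B, (p : Op m).PosSemidef → tr (p * D c b) = 0 := by
    intro p hp
    refine eq_zero_of_forall_nonneg (α := tr (p * D c c)) fun z => ?_
    have h1 := tr_mul_nonneg hp (hD (c + z • b))
    rw [expand, hDstar] at h1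
    have h2 : tr (p * star (D c b)) = star (tr (p * D c b)) := by
      rw [← tr_star, star_mul, star_eq_of_posSemidef hp, tr_mul_comm]
    simpa only [mul_add, map_add, mul_smul_comm, map_smul, h2, smul_eq_mul] using h1
  exact sub_eq_zero.1 (eq_zero_of_forall_tr_mul htr)

variable {T : A →ₗ[ℂ] B}

lemma map_star_of_isUnitalSchwarz_hsAdjoint (hT : IsUnitalSchwarz (hsAdjoint T)) (a : A) :
    T (star a) = star (T a) := by
  refine hs_right_injective fun b => ?_
  rw [← hs_hsAdjoint, hs_star_right, ← hT.map_star, hs_hsAdjoint_right, hs_star_right]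

lemma tr_map_of_isUnitalSchwarz_hsAdjoint (hT : IsUnitalSchwarz (hsAdjoint T)) (a : A) :
    tr (T a) = tr a := by
  have h := hs_hsAdjoint T 1 a
  rw [hT.1] at h
  simpa [hs_eq_tr] using h.symm

lemma posSemidef_map_of_isUnitalSchwarz_hsAdjoint (hT : IsUnitalSchwarz (hsAdjoint T)) {a : A}
    (ha : (a : Op n).PosSemidef) : ((T a : B) : Op m).PosSemidef := by
  refine posSemidef_of_trace_nonneg B Matrix.PosDef.one (T a).2 fun d hd => ?_
  let d' : B := ⟨d, hd⟩
  have h1 : hs (hsAdjoint T (star (star d') * star d')) a = tr (d' * star d' * T a) := by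
    rw [hs_hsAdjoint, hs_eq_tr, star_star]
    simp
  have h2 := hT.posSemidef_map (star d')
  rw [hs_eq_tr, star_eq_of_posSemidef h2] at h1
  have h3 := tr_mul_nonneg h2 ha
  rw [h1] at h3
  rw [one_mul, Matrix.trace_mul_comm, ← mul_assoc]
  exact h3

/-- Monotonicity of the inverse of the quadratic form of `mulSum`. -/
lemma hs_mulSum_sub (hT : IsUnitalSchwarz (hsAdjoint T)) (r s : ℝ) {ρ x a : A} {b : B}
    (hρ : star ρ = ρ) (ha : mulSum r s ρ a = x) (hb : mulSum r s (T ρ) b = T x) :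
    hs a x - hs b (T x) =
      hs (a - hsAdjoint T b) (mulSum r s ρ (a - hsAdjoint T b)) +
      (r * tr (ρ * (hsAdjoint T (star b * b) - star (hsAdjoint T b) * hsAdjoint T b)) +
       s * tr (ρ * (hsAdjoint T (b * star b) - hsAdjoint T b * star (hsAdjoint T b)))) := by
  have hTρ : ∀ c : B, tr (ρ * hsAdjoint T c) = tr (T ρ * c) := by
    intro c
    have := hs_hsAdjoint_right T c ρ
    rwa [hs_eq_tr, hs_eq_tr, hρ, ← map_star_of_isUnitalSchwarz_hsAdjoint hT, hρ] at this
  have h1 : hs b (T x) = r * tr (T ρ * (star b * b)) + s * tr (T ρ * (b * star b)) := by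
    rw [← hb, hs_mulSum_self]
  have h2 := hs_mulSum_self r s ρ (hsAdjoint T b)
  -- Both cross terms of the expanded square equal ⟨b, T x⟩; what remains is the difference between
  -- the forms at `b` and at T⋆b, which is the Schwarz defect.
  have h3 : hs a (mulSum r s ρ (hsAdjoint T b)) = hs b (T x) := by
    rw [← hs_mulSum_left r s hρ, ha, ← star_hs, hs_hsAdjoint, star_hs, ← hb]
    rw [hs_mulSum_left r s]
    rw [← map_star_of_isUnitalSchwarz_hsAdjoint hT, hρ]
  have h4 : hs (hsAdjoint T b) x = hs b (T x) := hs_hsAdjoint T b x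
  simp only [mul_sub, map_sub, hTρ, hs_sub_left, hs_sub_right, h2, h3, h4, ha]
  rw [h1]
  ring

end Schwarz
-- Monotonicity and its equality case.
section Monotonicity

variable {n m : ℕ} {A : Alg n} {B : Alg m} {T : A →ₗ[ℂ] B}

lemma IsUnitalSchwarz.posSemidef_sub_mul_star {Φ : A →ₗ[ℂ] B} (h : IsUnitalSchwarz Φ) (b : A) :
    ((Φ (b * star b) - Φ b * star (Φ b) : B) : Op m).PosSemidef := by
  have := h.2 (star b)
  rwa [h.map_star, star_star, star_star] at this

lemma hs_mulSum_gap_nonneg (hT : IsUnitalSchwarz (hsAdjoint T)) {r s : ℝ} (hr : 0 ≤ r)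
    (hs' : 0 ≤ s) {ρ : A} (hρ : (ρ : Op n).PosSemidef) (b : B) :
    0 ≤ r * tr (ρ * (hsAdjoint T (star b * b) - star (hsAdjoint T b) * hsAdjoint T b)) +
       s * tr (ρ * (hsAdjoint T (b * star b) - hsAdjoint T b * star (hsAdjoint T b))) := by
  have h1 := tr_mul_nonneg hρ (hT.2 b)
  have h2 := tr_mul_nonneg hρ (hT.posSemidef_sub_mul_star b)
  have hr' : (0 : ℂ) ≤ r := by exact_mod_cast hr
  have hs'' : (0 : ℂ) ≤ s := by exact_mod_cast hs'
  exact add_nonneg (mul_nonneg hr' h1) (mul_nonneg hs'' h2)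

lemma hs_le_hs_of_mulSum_eq (hT : IsUnitalSchwarz (hsAdjoint T)) {r s : ℝ} (hr : 0 ≤ r)
    (hs' : 0 ≤ s) {ρ x a : A} {b : B} (hρ : (ρ : Op n).PosSemidef) (ha : mulSum r s ρ a = x)
    (hb : mulSum r s (T ρ) b = T x) : hs b (T x) ≤ hs a x := by
  rw [← sub_nonneg, hs_mulSum_sub hT r s (star_eq_of_posSemidef hρ) ha hb]
  exact add_nonneg (hs_mulSum_self_nonneg hr hs' hρ _) (hs_mulSum_gap_nonneg hT hr hs' hρ b)

/-- Equality kills the square in `hs_mulSum_sub`, and one positive weight is enough for that form to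
be definite. This admits the point 0 of the support of a representing measure. -/
lemma hsAdjoint_eq_of_hs_eq (hT : IsUnitalSchwarz (hsAdjoint T)) {r s : ℝ} (hr : 0 ≤ r)
    (hs' : 0 ≤ s) (hrs : 0 < r ∨ 0 < s) {ρ x a : A} {b : B} (hρ : (ρ : Op n).PosDef)
    (ha : mulSum r s ρ a = x) (hb : mulSum r s (T ρ) b = T x) (h : hs b (T x) = hs a x) :
    hsAdjoint T b = a := by
  have h0 := hs_mulSum_sub hT r s (star_eq_of_posSemidef hρ.posSemidef) ha hb
  rw [h, sub_self, eq_comm, add_eq_zero_iff_of_nonneg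
    (hs_mulSum_self_nonneg hr hs' hρ.posSemidef _)
    (hs_mulSum_gap_nonneg hT hr hs' hρ.posSemidef b)] at h0
  exact (sub_eq_zero.1 (eq_zero_of_hs_mulSum_self hr hs' hrs hρ h0.1)).symm

/-- The pairs `(b, Φ b)` with `b` in the multiplicative domain of `Φ`. -/
def IsMultiplicativePair (Φ : A →ₗ[ℂ] B) (b : A) (a : B) : Prop :=
  Φ b = a ∧ (∀ c, Φ (c * b) = Φ c * a) ∧ ∀ c, Φ (b * c) = a * Φ c

lemma isMultiplicativePair_of_eq {Φ : A →ₗ[ℂ] B} (h : IsUnitalSchwarz Φ) {b : A}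
    (h1 : Φ (star b * b) = star (Φ b) * Φ b) (h2 : Φ (b * star b) = Φ b * star (Φ b)) :
    IsMultiplicativePair Φ b (Φ b) := by
  refine ⟨rfl, fun c => ?_, fun c => ?_⟩
  · have := h.map_mul_of_eq h1 (star c)
    rwa [star_star, h.map_star, star_star] at this
  · have h3 : Φ (star (star b) * star b) = star (Φ (star b)) * Φ (star b) := by
      rw [star_star, h.map_star, star_star, h2]
    have h4 := congrArg star (h.map_mul_of_eq h3 c)
    rwa [← h.map_star, star_mul, star_star, star_mul, star_star, star_star, h.map_star,
      star_star] at h4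

/-- With both weights positive and ρ faithful, the Schwarz defects at `b` and at b⋆ both vanish;
they control multiplication by `b` from the right and from the left. -/
lemma isMultiplicativePair_of_hs_eq (hT : IsUnitalSchwarz (hsAdjoint T)) {r s : ℝ} (hr : 0 < r)
    (hs' : 0 < s) {ρ x a : A} {b : B} (hρ : (ρ : Op n).PosDef)
    (ha : mulSum r s ρ a = x) (hb : mulSum r s (T ρ) b = T x) (h : hs b (T x) = hs a x) :
    IsMultiplicativePair (hsAdjoint T) b a := by
  have h0 := hs_mulSum_sub hT r s (star_eq_of_posSemidef hρ.posSemidef) ha hb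
  rw [h, sub_self, eq_comm, add_eq_zero_iff_of_nonneg
    (hs_mulSum_self_nonneg hr.le hs'.le hρ.posSemidef _)
    (hs_mulSum_gap_nonneg hT hr.le hs'.le hρ.posSemidef b)] at h0
  obtain ⟨h1, h2⟩ := tr_eq_zero_of_hs_mulSum_self_eq_zero hr.le hs'.le hρ.posSemidef
    (hT.2 b) (hT.posSemidef_sub_mul_star b) h0.2
  have hr0 : (r : ℂ) ≠ 0 := by exact_mod_cast hr.ne'
  have hs0 : (s : ℂ) ≠ 0 := by exact_mod_cast hs'.ne'
  have h3 := eq_zero_of_tr_mul_eq_zero hρ (hT.2 b) ((mul_eq_zero.1 h1).resolve_left hr0)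
  have h4 := eq_zero_of_tr_mul_eq_zero hρ (hT.posSemidef_sub_mul_star b)
    ((mul_eq_zero.1 h2).resolve_left hs0)
  rw [← hsAdjoint_eq_of_hs_eq hT hr.le hs'.le (Or.inl hr) hρ ha hb h]
  exact isMultiplicativePair_of_eq hT (sub_eq_zero.1 h3) (sub_eq_zero.1 h4)

end Monotonicity

/-! ### Spectral formula for the metrics. -/

section MetricFormula

open Matrix

variable {n : ℕ}

lemma posDef_modular {ρ : Op n} (hρ : ρ.PosDef) : (modular ρ).PosDef :=
  hρ.inv.transpose.kronecker hρ

lemma isUnit_rightMul {ρ : Op n} (hρ : ρ.PosDef) : IsUnit (rightMul ρ) :=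
  (hρ.transpose.kronecker PosDef.one).isUnit

lemma spectrum_pos_of_posDef {ι : Type*} [Fintype ι] [DecidableEq ι] {D : Matrix ι ι ℂ}
    (hD : D.PosDef) {t : ℝ} (ht : t ∈ spectrum ℝ D) : 0 < t := by
  rw [hD.isHermitian.spectrum_real_eq_range_eigenvalues] at ht
  obtain ⟨i, rfl⟩ := ht
  exact hD.eigenvalues_pos i

lemma cfc_mul_cfc_inv {ι : Type*} [Fintype ι] [DecidableEq ι] {D : Matrix ι ι ℂ}
    (hD : D.PosDef) {f : ℝ → ℝ} (hf : ∀ t, 0 < t → 0 < f t) :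
    cfc f D * cfc (fun t => (f t)⁻¹) D = 1 := by
  have hfin : ∀ f : ℝ → ℝ, ContinuousOn f (spectrum ℝ D) := fun f =>
    (Matrix.finite_real_spectrum (A := D)).continuousOn f
  have hsa : IsSelfAdjoint D := hD.isHermitian
  rw [← cfc_mul _ _ D (hfin _) (hfin _), ← cfc_const_one ℝ D]
  exact cfc_congr fun t ht => mul_inv_cancel₀ (hf t (spectrum_pos_of_posDef hD ht)).ne'

lemma J_inv {ρ : Op n} (hρ : ρ.PosDef) {f : ℝ → ℝ} (hf : ∀ t, 0 < t → 0 < f t) :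
    (J f ρ)⁻¹ = (rightMul ρ)⁻¹ * cfc (fun t => (f t)⁻¹) (modular ρ) := by
  rw [J, Matrix.mul_inv_rev, Matrix.inv_eq_right_inv (cfc_mul_cfc_inv (posDef_modular hρ) hf)]

/-- Spectral decomposition. The point is that the eigenprojections do not depend on `g`, so metrics
for different functions can be compared. -/
lemma exists_cfc_eq_sum {ι : Type*} [Fintype ι] [DecidableEq ι] {D : Matrix ι ι ℂ}
    (hD : D.IsHermitian) : ∃ P : ι → Matrix ι ι ℂ, ∀ g : ℝ → ℝ,
      cfc g D = ∑ i, (g (hD.eigenvalues i) : ℂ) • P i := by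
  refine ⟨fun i => (hD.eigenvectorUnitary : Matrix ι ι ℂ) * single i i 1 *
    (star hD.eigenvectorUnitary : Matrix ι ι ℂ), fun g => ?_⟩
  rw [hD.cfc_eq, IsHermitian.cfc, Unitary.conjStarAlgAut_apply]
  have hdiag : diagonal (RCLike.ofReal ∘ g ∘ hD.eigenvalues : ι → ℂ) =
      ∑ i, (g (hD.eigenvalues i) : ℂ) • single i i (1 : ℂ) := by
    ext k l
    rcases eq_or_ne k l with rfl | h
    · simp [Matrix.sum_apply, single_apply]
    · rw [diagonal_apply_ne _ h, Matrix.sum_apply]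
      refine (Finset.sum_eq_zero fun i _ => ?_).symm
      rw [Matrix.smul_apply, single_apply, if_neg fun h' => h (h'.1.symm.trans h'.2), smul_zero]
  rw [hdiag, Matrix.mul_sum, Matrix.sum_mul]
  exact Finset.sum_congr rfl fun i _ => by rw [Matrix.mul_smul, Matrix.smul_mul]

/-- The metric is given by a finite spectral measure on `(0, ∞)`. -/
lemma exists_metric_eq_sum {ρ : Op n} (hρ : ρ.PosDef) (x y : Op n) :
    ∃ (u : Fin n × Fin n → ℝ) (μ : Fin n × Fin n → ℂ), (∀ i, 0 < u i) ∧
      ∀ f : ℝ → ℝ, (∀ t, 0 < t → 0 < f t) →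
        metric f ρ x y = ∑ i, μ i * (((f (u i))⁻¹ : ℝ) : ℂ) := by
  obtain ⟨P, hP⟩ := exists_cfc_eq_sum (posDef_modular hρ).isHermitian
  let ℓ : Matrix (Fin n × Fin n) (Fin n × Fin n) ℂ →ₗ[ℂ] ℂ :=
    { toFun := fun M => (of (fun i j => (M.mulVec x.vec) (j, i)) * y).trace
      map_add' := fun M N => by
        rw [← trace_add, ← add_mul, add_mulVec]
        rfl
      map_smul' := fun c M => by
        rw [smul_mulVec, RingHom.id_apply, ← trace_smul, ← Matrix.smul_mul]
        rfl }
  refine ⟨(posDef_modular hρ).isHermitian.eigenvalues, fun i => ℓ ((rightMul ρ)⁻¹ * P i),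
    (posDef_modular hρ).eigenvalues_pos, fun f hf => ?_⟩
  have h1 : metric f ρ x y = ℓ ((J f ρ)⁻¹) := rfl
  rw [h1, J_inv hρ hf, hP, Matrix.mul_sum, map_sum]
  exact Finset.sum_congr rfl fun i _ => by rw [Matrix.mul_smul, map_smul, smul_eq_mul, mul_comm]

/-- The matrix of the operator `b ↦ r b ρ + s ρ b`. -/
noncomputable def mulSumMatrix (r s : ℝ) (ρ : Op n) : Matrix (Fin n × Fin n) (Fin n × Fin n) ℂ :=
  (r : ℂ) • rightMul ρ + (s : ℂ) • ((1 : Op n) ⊗ₖ ρ)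

lemma mulSumMatrix_mulVec (r s : ℝ) (ρ b : Op n) :
    (mulSumMatrix r s ρ).mulVec b.vec = ((r : ℂ) • (b * ρ) + (s : ℂ) • (ρ * b)).vec := by
  rw [mulSumMatrix, add_mulVec, smul_mulVec, smul_mulVec, rightMul_mulVec, kronecker_mulVec_vec]
  simp

/-- The product Δ_ρ R_ρ is left multiplication by ρ. -/
lemma J_add_mul {ρ : Op n} (hρ : ρ.PosDef) (r s : ℝ) :
    J (fun t => r + s * t) ρ = mulSumMatrix r s ρ := by
  have hD := posDef_modular hρ
  have hfin : ∀ f : ℝ → ℝ, ContinuousOn f (spectrum ℝ (modular ρ)) := fun f =>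
    (Matrix.finite_real_spectrum (A := modular ρ)).continuousOn f
  have hsa : IsSelfAdjoint (modular ρ) := hD.isHermitian
  have h1 : modular ρ * rightMul ρ = (1 : Op n) ⊗ₖ ρ := by
    rw [modular, rightMul, ← mul_kronecker_mul, mul_one, ← transpose_mul,
      Matrix.mul_nonsing_inv _ ((isUnit_iff_isUnit_det _).1 hρ.isUnit), transpose_one]
  rw [J, cfc_add (a := modular ρ) (fun _ => r) (fun t => s * t) (hfin _) (hfin _),
    cfc_const r (modular ρ), cfc_const_mul s (fun t => t) (modular ρ) (hfin _),
    cfc_id' ℝ (modular ρ), add_mul, smul_mul_assoc, h1, mulSumMatrix,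
    Algebra.algebraMap_eq_smul_one, smul_mul_assoc, one_mul]
  rfl

lemma mulSumMatrix_inv_mulVec {ρ : Op n} (hρ : ρ.PosDef) {r s : ℝ} (hr : 0 ≤ r) (hs' : 0 ≤ s)
    (hrs : 0 < r ∨ 0 < s) (b : Op n) :
    (mulSumMatrix r s ρ)⁻¹.mulVec ((r : ℂ) • (b * ρ) + (s : ℂ) • (ρ * b)).vec = b.vec := by
  have hf : ∀ t : ℝ, 0 < t → 0 < r + s * t := by
    intro t ht
    rcases hrs with h | h <;> positivity
  have hu : IsUnit (mulSumMatrix r s ρ) := by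
    rw [← J_add_mul hρ, J]
    exact (IsUnit.of_mul_eq_one _ (cfc_mul_cfc_inv (posDef_modular hρ) hf)).mul
      (isUnit_rightMul hρ)
  rw [← mulSumMatrix_mulVec, mulVec_mulVec,
    Matrix.nonsing_inv_mul _ ((isUnit_iff_isUnit_det _).1 hu), one_mulVec]

lemma metric_add_mul {ρ : Op n} (hρ : ρ.PosDef) {r s : ℝ} (hr : 0 ≤ r) (hs' : 0 ≤ s)
    (hrs : 0 < r ∨ 0 < s) {b x : Op n} (hb : (r : ℂ) • (b * ρ) + (s : ℂ) • (ρ * b) = x) (y : Op n) :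
    metric (fun t => r + s * t) ρ x y = (b * y).trace := by
  rw [metric, JInv, J_add_mul hρ, ← hb, mulSumMatrix_inv_mulVec hρ hr hs' hrs]
  rfl

end MetricFormula

/-! ### Comparing the metrics of ρ and T(ρ). -/

section MetricComparison

variable {n m : ℕ} {A : Alg n} {B : Alg m} {T : A →ₗ[ℂ] B}

/-- The metric is Tr ax and the pairing is Tr a⋆x; for self-adjoint x they are conjugate, and the
pairing is real because the form is nonnegative. -/
lemma metric_add_mul_self {r s : ℝ} (hr : 0 ≤ r) (hs' : 0 ≤ s) (hrs : 0 < r ∨ 0 < s) {ρ x a : A}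
    (hρ : (ρ : Op n).PosDef) (hx : star x = x) (ha : mulSum r s ρ a = x) :
    metric (fun t => r + s * t) (ρ : Op n) x x = hs a x := by
  have h1 : metric (fun t => r + s * t) (ρ : Op n) x x = tr (a * x) :=
    metric_add_mul hρ hr hs' hrs (congrArg Subtype.val ha) _
  have h2 : 0 ≤ hs a x := by
    rw [← ha]
    exact hs_mulSum_self_nonneg hr hs' hρ.posSemidef a
  rw [h1, tr_mul_comm, ← (IsSelfAdjoint.of_nonneg h2).star_eq, star_hs, hs_eq_tr, hx]

lemma metric_add_mul_self_nonneg {r s : ℝ} (hr : 0 ≤ r) (hs' : 0 ≤ s) (hrs : 0 < r ∨ 0 < s)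
    {ρ x : A} (hρ : (ρ : Op n).PosDef) (hx : star x = x) :
    0 ≤ metric (fun t => r + s * t) (ρ : Op n) x x := by
  obtain ⟨a, ha⟩ := mulSum_surjective hr hs' hrs hρ x
  rw [metric_add_mul_self hr hs' hrs hρ hx ha, ← ha]
  exact hs_mulSum_self_nonneg hr hs' hρ.posSemidef a

lemma metric_map_le (hT : IsUnitalSchwarz (hsAdjoint T)) {r s : ℝ} (hr : 0 ≤ r) (hs' : 0 ≤ s)
    (hrs : 0 < r ∨ 0 < s) {ρ x : A} (hρ : (ρ : Op n).PosDef) (hτ : (T ρ : Op m).PosDef)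
    (hx : star x = x) :
    metric (fun t => r + s * t) (T ρ : Op m) (T x) (T x) ≤
      metric (fun t => r + s * t) (ρ : Op n) x x := by
  obtain ⟨a, ha⟩ := mulSum_surjective hr hs' hrs hρ x
  obtain ⟨b, hb⟩ := mulSum_surjective hr hs' hrs hτ (T x)
  have hTx : star (T x) = T x := by rw [← map_star_of_isUnitalSchwarz_hsAdjoint hT, hx]
  rw [metric_add_mul_self hr hs' hrs hρ hx ha, metric_add_mul_self hr hs' hrs hτ hTx hb]
  exact hs_le_hs_of_mulSum_eq hT hr hs' hρ.posSemidef ha hb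

lemma metric_eq_of_forall_add_mul_eq {ρ x : Op n} {τ y : Op m} (hρ : ρ.PosDef) (hτ : τ.PosDef)
    (h : ∀ s : ℝ, 0 < s →
      metric (fun t => s + 1 * t) ρ x x = metric (fun t => s + 1 * t) τ y y)
    {f : ℝ → ℝ} (hf : ∀ t, 0 < t → 0 < f t) : metric f ρ x x = metric f τ y y := by
  obtain ⟨u, μ, hu, hμ⟩ := exists_metric_eq_sum hρ x x
  obtain ⟨v, ν, hv, hν⟩ := exists_metric_eq_sum hτ y y
  rw [hμ f hf, hν f hf]
  refine sum_mul_eq_of_sum_mul_inv_add_eq u v hu hv μ ν (fun s hs' => ?_) fun t => (f t)⁻¹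
  have hpos : ∀ t : ℝ, 0 < t → 0 < s + 1 * t := fun t ht => by positivity
  have := h s hs'
  rw [hμ _ hpos, hν _ hpos] at this
  simpa only [one_mul] using this

open MeasureTheory in
-- A positive value at `s` would persist on a relative neighbourhood of `s` in [0, ∞), which has
-- positive measure, so the integral would be positive.
lemma eq_zero_of_mem_support {ν : Measure ℝ} (hν : ν (Set.Iio 0) = 0) {d : ℝ → ℝ}
    (hd : ContinuousOn d (Set.Ici 0)) (hnn : ∀ s, 0 ≤ s → 0 ≤ d s) (hint : Integrable d ν)
    (h0 : ∫ s, d s ∂ν ≤ 0) {s : ℝ} (hs' : s ∈ ν.support) : 0 ≤ s ∧ d s = 0 := by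
  rw [Measure.mem_support_iff_forall] at hs'
  have hs0 : 0 ≤ s := by
    by_contra hlt
    exact (hs' _ (Iio_mem_nhds (not_le.1 hlt))).ne' hν
  refine ⟨hs0, ?_⟩
  have hae : ∀ᵐ t ∂ν, 0 ≤ t := by
    rw [ae_iff]
    simpa [Set.Iio] using hν
  have hae' : 0 ≤ᵐ[ν] d := hae.mono fun t ht => hnn t ht
  have hzero : d =ᵐ[ν] 0 :=
    (integral_eq_zero_iff_of_nonneg_ae hae' hint).1 (le_antisymm h0 (integral_nonneg_of_ae hae'))
  by_contra hne
  have hpos : 0 < d s := lt_of_le_of_ne (hnn s hs0) (Ne.symm hne)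
  have hev : ∀ᶠ t in nhdsWithin s (Set.Ici 0), 0 < d t :=
    (hd s hs0).eventually (lt_mem_nhds hpos)
  rw [eventually_nhdsWithin_iff] at hev
  have h1 := hs' _ hev
  have h2 : ∀ᵐ t ∂ν, ¬ (t ∈ Set.Ici (0 : ℝ) → 0 < d t) := by
    filter_upwards [hae, hzero] with t ht ht0 h
    have := h ht
    rw [ht0] at this
    exact lt_irrefl _ this
  rw [ae_iff] at h2
  simp only [not_not] at h2
  exact h1.ne' h2

/-- Equality of the metrics for `f` gives equality for all functions `s + t` with `s` in the support
of a representing measure of `f`. -/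
lemma metric_eq_of_mem_support (hT : IsUnitalSchwarz (hsAdjoint T)) {ρ x : A}
    (hρ : (ρ : Op n).PosDef) (hτ : (T ρ : Op m).PosDef) (hx : star x = x) {f : ℝ → ℝ}
    (hf : ∀ t, 0 < t → 0 < f t) {ν : MeasureTheory.Measure ℝ} (hν : IsRepresentingMeasure f ν)
    (h : metric f (ρ : Op n) x x = metric f (T ρ : Op m) (T x) (T x)) {s : ℝ}
    (hs' : s ∈ ν.support) :
    0 ≤ s ∧ metric (fun t => s + 1 * t) (ρ : Op n) x x =
      metric (fun t => s + 1 * t) (T ρ : Op m) (T x) (T x) := by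
  obtain ⟨u, μ, hu, hμ⟩ := exists_metric_eq_sum hρ (x : Op n) x
  obtain ⟨v, κ, hv, hκ⟩ := exists_metric_eq_sum hτ (T x : Op m) (T x)
  have hTx : star (T x) = T x := by rw [← map_star_of_isUnitalSchwarz_hsAdjoint hT, hx]
  obtain ⟨hν0, c, hc, hrep⟩ := hν
  have hre : ∀ {k : ℕ} (w : Fin k × Fin k → ℂ) (g : Fin k × Fin k → ℝ),
      (∑ i, w i * ((g i : ℝ) : ℂ)).re = ∑ i, (w i).re * g i := fun w g => by
    simp [Complex.re_sum]
  let d : ℝ → ℝ := fun s => ∑ i, (μ i).re * (s + u i)⁻¹ - ∑ j, (κ j).re * (s + v j)⁻¹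
  have hpos : ∀ s : ℝ, 0 ≤ s → ∀ t : ℝ, 0 < t → 0 < s + 1 * t := fun s hs0 t ht => by positivity
  have hds : ∀ s : ℝ, 0 ≤ s → d s = (metric (fun t => s + 1 * t) (ρ : Op n) x x -
      metric (fun t => s + 1 * t) (T ρ : Op m) (T x) (T x)).re := by
    intro s hs0
    rw [hμ _ (hpos s hs0), hκ _ (hpos s hs0), Complex.sub_re, hre, hre]
    simp only [one_mul, d]
  have hle : ∀ r q : ℝ, 0 ≤ r → 0 ≤ q → (0 < r ∨ 0 < q) →
      0 ≤ (metric (fun t => r + q * t) (ρ : Op n) x x -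
      metric (fun t => r + q * t) (T ρ : Op m) (T x) (T x)).re := fun r q hr hq hrq =>
    (Complex.nonneg_iff.1 (sub_nonneg.2 (metric_map_le hT hr hq hrq hρ hτ hx))).1
  have hnn : ∀ s, 0 ≤ s → 0 ≤ d s := fun s hs0 => by
    rw [hds s hs0]
    exact hle s 1 hs0 zero_le_one (Or.inr one_pos)
  have hcont : ContinuousOn d (Set.Ici 0) := by
    have hinv : ∀ w : ℝ, 0 < w → ContinuousOn (fun s : ℝ => (s + w)⁻¹) (Set.Ici 0) := by
      intro w hw
      refine ContinuousOn.inv₀ (by fun_prop) fun s hs0 => ?_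
      have : (0 : ℝ) ≤ s := hs0
      positivity
    refine ContinuousOn.sub ?_ ?_ <;> refine continuousOn_finsetSum _ fun i _ => ?_
    · exact continuousOn_const.mul (hinv _ (hu i))
    · exact continuousOn_const.mul (hinv _ (hv i))
  have hiu : ∀ i, MeasureTheory.Integrable (fun s => (μ i).re * (s + u i)⁻¹) ν := fun i =>
    (hrep _ (hu i)).1.const_mul _
  have hiv : ∀ i, MeasureTheory.Integrable (fun s => (κ i).re * (s + v i)⁻¹) ν := fun i =>
    (hrep _ (hv i)).1.const_mul _
  have hint : MeasureTheory.Integrable d ν :=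
    (MeasureTheory.integrable_finsetSum _ fun i _ => hiu i).sub
      (MeasureTheory.integrable_finsetSum _ fun i _ => hiv i)
  have hI : ∫ s, d s ∂ν = ∑ i, (μ i).re * ((f (u i))⁻¹ - c) - ∑ j, (κ j).re * ((f (v j))⁻¹ - c) := by
    simp only [d]
    rw [MeasureTheory.integral_sub (MeasureTheory.integrable_finsetSum _ fun i _ => hiu i)
      (MeasureTheory.integrable_finsetSum _ fun i _ => hiv i),
      MeasureTheory.integral_finsetSum _ fun i _ => hiu i,
      MeasureTheory.integral_finsetSum _ fun i _ => hiv i]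
    congr 1 <;> refine Finset.sum_congr rfl fun i _ => ?_
    · rw [MeasureTheory.integral_const_mul, (hrep _ (hu i)).2, add_sub_cancel_left]
    · rw [MeasureTheory.integral_const_mul, (hrep _ (hv i)).2, add_sub_cancel_left]
  have h0 : ∫ s, d s ∂ν ≤ 0 := by
    have h1 := congrArg Complex.re h
    rw [hμ f hf, hκ f hf, hre, hre] at h1
    -- The weights (1, 0) give the constant function 1, whose metric carries the term c of 1/f; it
    -- too decreases under `T`, so removing it leaves a nonpositive integral.
    have h2 := hle 1 0 zero_le_one le_rfl (Or.inl one_pos)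
    have hone : ∀ t : ℝ, 0 < t → 0 < (1 : ℝ) + 0 * t := fun t _ => by simp
    rw [hμ _ hone, hκ _ hone, Complex.sub_re, hre, hre] at h2
    simp only [zero_mul, add_zero, inv_one, mul_one] at h2
    rw [hI]
    simp only [mul_sub, Finset.sum_sub_distrib, ← Finset.sum_mul]
    nlinarith
  obtain ⟨hs0, hd0⟩ := eq_zero_of_mem_support hν0 hcont hnn hint h0 hs'
  refine ⟨hs0, ?_⟩
  rw [hds s hs0] at hd0
  have h3 := metric_map_le hT hs0 zero_le_one (Or.inr one_pos) hρ hτ hx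
  rw [← sub_nonneg] at h3
  exact sub_eq_zero.1 (Complex.ext hd0 (Complex.nonneg_iff.1 h3).2.symm)

end MetricComparison

/-! ### Cyclic subspaces of conjugation operators. -/

section Conjugation

open Polynomial

variable {K V : Type*} [Field K] [AddCommGroup V] [Module K V] [FiniteDimensional K V]

/-- The largest `D`-invariant subspace of `W` contains `y`. In finite dimension the injective
operator q(D) maps it onto itself, so it also contains the unique preimage `w`. -/
lemma aeval_mem_of_aeval_eq (D : Module.End K V) (W : Submodule K V) {y w : V}
    (hy : ∀ p : K[X], aeval D p y ∈ W) (q : K[X]) (hq : Function.Injective (aeval D q))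
    (hw : aeval D q w = y) (p : K[X]) : aeval D p w ∈ W := by
  let Y : Submodule K V :=
    { carrier := {v | ∀ p : K[X], aeval D p v ∈ W}
      add_mem' := fun ha hb p => by
        rw [map_add]
        exact W.add_mem (ha p) (hb p)
      zero_mem' := fun p => by
        rw [map_zero]
        exact W.zero_mem
      smul_mem' := fun c v hv p => by
        rw [map_smul]
        exact W.smul_mem c (hv p) }
  have hmaps : ∀ v ∈ Y, aeval D q v ∈ Y := by
    intro v hv p
    rw [← Module.End.mul_apply, ← map_mul]
    exact hv _
  have hinj : Function.Injective ((aeval D q).restrict hmaps) := fun a b hab =>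
    Subtype.ext (hq (congrArg Subtype.val hab))
  obtain ⟨v, hv⟩ := LinearMap.injective_iff_surjective.1 hinj ⟨y, hy⟩
  have h1 : aeval D q (v : V) = y := congrArg Subtype.val hv
  rw [hq (hw.trans h1.symm)]
  exact v.2 p

/-- The operator `v ↦ u v u⁻¹`. -/
def conjOp {R : Type*} [Ring R] [Algebra K R] (u : Rˣ) : Module.End K R :=
  LinearMap.mulLeft K (u : R) ∘ₗ LinearMap.mulRight K ((u⁻¹ : Rˣ) : R)

lemma conjOp_apply {R : Type*} [Ring R] [Algebra K R] (u : Rˣ) (v : R) :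
    conjOp (K := K) u v = u * (v * ((u⁻¹ : Rˣ) : R)) := rfl

lemma conjOp_injective {R : Type*} [Ring R] [Algebra K R] (u : Rˣ) :
    Function.Injective (conjOp (K := K) u) := by
  intro a b hab
  rw [conjOp_apply, conjOp_apply] at hab
  simpa using hab

/-- The translates are the integer powers of the conjugation operator at `y`; the negative ones are
reached by dividing by the injective operator for the polynomial X. -/
lemma aeval_conjOp_zpow_mem {R : Type*} [Ring R] [Algebra K R] [FiniteDimensional K R] (u : Rˣ)
    (W : Submodule K R) {y : R} (hy : ∀ p : K[X], aeval (conjOp (K := K) u) p y ∈ W) (k : ℤ) :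
    ((u ^ k : Rˣ) : R) * y * ((u ^ (-k) : Rˣ) : R) ∈ W := by
  have hinj : Function.Injective (aeval (conjOp (K := K) u) (X : K[X])) := by
    rw [aeval_X]
    exact conjOp_injective u
  suffices h : ∀ p : K[X], aeval (conjOp (K := K) u) p
      (((u ^ k : Rˣ) : R) * y * ((u ^ (-k) : Rˣ) : R)) ∈ W by
    simpa using h 1
  have step : ∀ k : ℤ, conjOp (K := K) u (((u ^ k : Rˣ) : R) * y * ((u ^ (-k) : Rˣ) : R)) =
      ((u ^ (k + 1) : Rˣ) : R) * y * ((u ^ (-(k + 1)) : Rˣ) : R) := by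
    intro k
    rw [conjOp_apply, ← mul_self_zpow, show -(k + 1) = -k + -1 by ring, zpow_add u (-k),
      zpow_neg_one]
    simp only [Units.val_mul, mul_assoc]
  induction k using Int.induction_on with
  | zero => simpa using hy
  | succ k ih =>
    intro p
    have := ih (p * X)
    rwa [map_mul (aeval (conjOp (K := K) u)), aeval_X, Module.End.mul_apply, step] at this
  | pred k ih =>
    refine aeval_mem_of_aeval_eq _ W ih X hinj ?_
    rw [aeval_X, step, sub_add_cancel]

end Conjugation

/-! ### Resolvents of the modular operators on B × A. -/

section Resolvents

open Polynomial

variable {n m : ℕ} {A : Alg n} {B : Alg m}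

lemma finrank_alg_le (A : Alg n) : Module.finrank ℂ A ≤ n ^ 2 := by
  have h : Module.finrank ℂ (Op n) = n ^ 2 := by
    rw [Module.finrank_matrix]
    simp [sq]
  rw [← h]
  exact Submodule.finrank_le (Subalgebra.toSubmodule A.toSubalgebra)

/-- The link with resolvents: solving s aρ + ρa = x means a = (Δ_ρ + s)⁻¹(xρ⁻¹). -/
lemma conjOp_add_smul (ρ : Aˣ) (s : ℝ) (a : A) :
    conjOp (K := ℂ) ρ a + (s : ℂ) • a = mulSum s 1 (ρ : A) a * ((ρ⁻¹ : Aˣ) : A) := by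
  rw [conjOp_apply, mulSum_apply, add_mul, smul_mul_assoc, mul_assoc a, Units.mul_inv, mul_one,
    smul_mul_assoc, Complex.ofReal_one, one_smul, mul_assoc, add_comm]

/-- The pair of units `(τ, ρ)`. -/
def prodUnit (τ : Bˣ) (ρ : Aˣ) : (B × A)ˣ := MulEquiv.prodUnits.symm (τ, ρ)

lemma conjOp_prodUnit (τ : Bˣ) (ρ : Aˣ) (v : B × A) :
    conjOp (K := ℂ) (prodUnit τ ρ) v = (conjOp (K := ℂ) τ v.1, conjOp (K := ℂ) ρ v.2) := rfl

lemma conjOp_prodUnit_add_smul (τ : Bˣ) (ρ : Aˣ) (s : ℝ) (v : B × A) :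
    conjOp (K := ℂ) (prodUnit τ ρ) v + (s : ℂ) • v =
      (mulSum s 1 (τ : B) v.1 * ((τ⁻¹ : Bˣ) : B), mulSum s 1 (ρ : A) v.2 * ((ρ⁻¹ : Aˣ) : A)) := by
  rw [conjOp_prodUnit]
  exact Prod.ext (conjOp_add_smul τ s v.1) (conjOp_add_smul ρ s v.2)

lemma conjOp_prodUnit_add_smul_injective {τ : Bˣ} {ρ : Aˣ} (hτ : ((τ : B) : Op m).PosDef)
    (hρ : ((ρ : A) : Op n).PosDef) {s : ℝ} (hs' : 0 ≤ s) :
    Function.Injective fun v => conjOp (K := ℂ) (prodUnit τ ρ) v + (s : ℂ) • v := by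
  intro v w hvw
  simp only [conjOp_prodUnit_add_smul, Prod.mk.injEq, Units.mul_left_inj] at hvw
  exact Prod.ext (mulSum_injective hs' zero_le_one (Or.inr one_pos) hτ hvw.1)
    (mulSum_injective hs' zero_le_one (Or.inr one_pos) hρ hvw.2)

/-- The number n² + m² enters here, as a bound for the dimension of B × A. -/
lemma aeval_conjOp_mem {τ : Bˣ} {ρ : Aˣ} (hτ : ((τ : B) : Op m).PosDef)
    (hρ : ((ρ : A) : Op n).PosDef) (W : Submodule ℂ (B × A)) (y : B) (x : A) (σ : Finset ℝ)
    (hσ : n ^ 2 + m ^ 2 ≤ σ.card) (hσ0 : ∀ s ∈ σ, 0 ≤ s)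
    (h : ∀ s ∈ σ, ∀ b a, mulSum s 1 (τ : B) b = y → mulSum s 1 (ρ : A) a = x → (b, a) ∈ W)
    (p : ℂ[X]) : aeval (conjOp (K := ℂ) (prodUnit τ ρ)) p
      (y * ((τ⁻¹ : Bˣ) : B), x * ((ρ⁻¹ : Aˣ) : A)) ∈ W := by
  classical
  refine aeval_mem_of_resolvent_mem _ W _ (σ.image fun s : ℝ => -(s : ℂ)) ?_ ?_ ?_ p
  · rw [Finset.card_image_of_injective _ fun a b hab => by simpa using hab, Module.finrank_prod]
    have := finrank_alg_le A
    have := finrank_alg_le B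
    omega
  · intro z hz
    obtain ⟨s, hs', rfl⟩ := Finset.mem_image.1 hz
    simpa only [neg_smul, sub_neg_eq_add] using
      conjOp_prodUnit_add_smul_injective hτ hρ (hσ0 s hs')
  · intro z hz
    obtain ⟨s, hs', rfl⟩ := Finset.mem_image.1 hz
    obtain ⟨b, hb⟩ := mulSum_surjective (hσ0 s hs') zero_le_one (Or.inr one_pos) hτ y
    obtain ⟨a, ha⟩ := mulSum_surjective (hσ0 s hs') zero_le_one (Or.inr one_pos) hρ x
    refine ⟨(b, a), h s hs' b a hb ha, ?_⟩
    rw [neg_smul, sub_neg_eq_add, conjOp_prodUnit_add_smul, hb, ha]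

lemma mem_of_aeval_conjOp_mem {τ : Bˣ} {ρ : Aˣ} (hτ : ((τ : B) : Op m).PosDef)
    (hρ : ((ρ : A) : Op n).PosDef) (W : Submodule ℂ (B × A)) {y : B} {x : A}
    (h : ∀ p : ℂ[X], aeval (conjOp (K := ℂ) (prodUnit τ ρ)) p
      (y * ((τ⁻¹ : Bˣ) : B), x * ((ρ⁻¹ : Aˣ) : A)) ∈ W) {s : ℝ} (hs' : 0 ≤ s) {b : B} {a : A}
    (hb : mulSum s 1 (τ : B) b = y) (ha : mulSum s 1 (ρ : A) a = x) : (b, a) ∈ W := by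
  have hq : ∀ v, aeval (conjOp (K := ℂ) (prodUnit τ ρ)) (X + C (s : ℂ)) v =
      conjOp (K := ℂ) (prodUnit τ ρ) v + (s : ℂ) • v := fun v => by
    rw [map_add, aeval_X, aeval_C, LinearMap.add_apply, Module.algebraMap_end_apply]
  have := aeval_mem_of_aeval_eq (conjOp (K := ℂ) (prodUnit τ ρ)) W h (X + C (s : ℂ))
    (w := (b, a)) ?_ ?_ 1
  · simpa using this
  · have h1 := conjOp_prodUnit_add_smul_injective hτ hρ hs'
    intro v w hvw
    rw [hq, hq] at hvw
    exact h1 hvw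
  · rw [hq, conjOp_prodUnit_add_smul, hb, ha]

variable {T : A →ₗ[ℂ] B}

/-- Equality of the metrics for sufficiently many functions `s + t` gives equality for all `s`. -/
lemma metric_eq_of_finset (hT : IsUnitalSchwarz (hsAdjoint T)) {ρ x : A}
    (hρ : (ρ : Op n).PosDef) (hτ : (T ρ : Op m).PosDef) (hx : star x = x) (σ : Finset ℝ)
    (hσ : n ^ 2 + m ^ 2 ≤ σ.card) (hσ0 : ∀ s ∈ σ, 0 ≤ s)
    (h : ∀ s ∈ σ, metric (fun t => s + 1 * t) (ρ : Op n) x x =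
      metric (fun t => s + 1 * t) (T ρ : Op m) (T x) (T x)) {s : ℝ} (hs' : 0 < s) :
    metric (fun t => s + 1 * t) (ρ : Op n) x x =
      metric (fun t => s + 1 * t) (T ρ : Op m) (T x) (T x) := by
  have hTx : star (T x) = T x := by rw [← map_star_of_isUnitalSchwarz_hsAdjoint hT, hx]
  obtain ⟨ρ', hρ'⟩ := isUnit_of_posDef hρ
  obtain ⟨τ', hτ'⟩ := isUnit_of_posDef hτ
  -- The graph of T⋆. Multiplicative pairs would not do at this stage: s = 0 is allowed, and there
  -- only one of the two Schwarz defects is known to vanish.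
  let W : Submodule ℂ (B × A) := LinearMap.ker
    (hsAdjoint T ∘ₗ LinearMap.fst ℂ B A - LinearMap.snd ℂ B A)
  have hW : ∀ b a, (b, a) ∈ W ↔ hsAdjoint T b = a := fun b a => by
    simp [W, sub_eq_zero]
  have h1 := aeval_conjOp_mem (τ := τ') (ρ := ρ') (hτ' ▸ hτ) (hρ' ▸ hρ) W (T x) x σ hσ hσ0 (by
    intro s hs' b a hb ha
    rw [hτ'] at hb
    rw [hρ'] at ha
    rw [hW]
    refine hsAdjoint_eq_of_hs_eq hT (hσ0 s hs') zero_le_one (Or.inr one_pos) hρ ha hb ?_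
    rw [← metric_add_mul_self (hσ0 s hs') zero_le_one (Or.inr one_pos) hρ hx ha,
      ← metric_add_mul_self (hσ0 s hs') zero_le_one (Or.inr one_pos) hτ hTx hb, h s hs'])
  obtain ⟨a, ha⟩ := mulSum_surjective hs'.le zero_le_one (Or.inr one_pos) hρ x
  obtain ⟨b, hb⟩ := mulSum_surjective hs'.le zero_le_one (Or.inr one_pos) hτ (T x)
  have h2 := mem_of_aeval_conjOp_mem (τ := τ') (ρ := ρ') (hτ' ▸ hτ) (hρ' ▸ hρ) W h1 hs'.le
    (hτ'.symm ▸ hb) (hρ'.symm ▸ ha)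
  rw [metric_add_mul_self hs'.le zero_le_one (Or.inr one_pos) hρ hx ha,
    metric_add_mul_self hs'.le zero_le_one (Or.inr one_pos) hτ hTx hb, ← (hW b a).1 h2,
    hs_hsAdjoint]

/-- The pairs `(b, a)` all of whose modular translates are multiplicative pairs of `Φ`. -/
def multiplicativePairs (Φ : B →ₗ[ℂ] A) (hΦ : ∀ b, Φ (star b) = star (Φ b)) (hΦ1 : Φ 1 = 1)
    (u : (B × A)ˣ) (hu : star u = u) : StarSubalgebra ℂ (B × A) where
  carrier := {v | ∀ k : ℤ, IsMultiplicativePair Φ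
    (((u ^ k : (B × A)ˣ) : B × A) * v * ((u ^ (-k) : (B × A)ˣ) : B × A)).1
    (((u ^ k : (B × A)ˣ) : B × A) * v * ((u ^ (-k) : (B × A)ˣ) : B × A)).2}
  mul_mem' := by
    intro v w hv hw k
    have h : ((u ^ k : (B × A)ˣ) : B × A) * (v * w) * ((u ^ (-k) : (B × A)ˣ) : B × A) =
        (((u ^ k : (B × A)ˣ) : B × A) * v * ((u ^ (-k) : (B × A)ˣ) : B × A)) *
        (((u ^ k : (B × A)ˣ) : B × A) * w * ((u ^ (-k) : (B × A)ˣ) : B × A)) := by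
      simp [mul_assoc]
    obtain ⟨h1, h2, h3⟩ := hv k
    obtain ⟨h4, h5, h6⟩ := hw k
    rw [h]
    refine ⟨?_, fun c => ?_, fun c => ?_⟩
    · rw [Prod.fst_mul, Prod.snd_mul, h5, h1]
    · rw [Prod.fst_mul, Prod.snd_mul, ← mul_assoc, h5, h2, mul_assoc]
    · rw [Prod.fst_mul, Prod.snd_mul]
      exact (congrArg Φ (mul_assoc _ _ _)).trans
        ((h3 _).trans ((congrArg _ (h6 c)).trans (mul_assoc _ _ _).symm))
  add_mem' := by
    intro v w hv hw k
    rw [mul_add, add_mul]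
    obtain ⟨h1, h2, h3⟩ := hv k
    obtain ⟨h4, h5, h6⟩ := hw k
    refine ⟨?_, fun c => ?_, fun c => ?_⟩
    · rw [Prod.fst_add, Prod.snd_add, map_add, h1, h4]
    · rw [Prod.fst_add, Prod.snd_add, mul_add, map_add, h2, h5, mul_add]
    · rw [Prod.fst_add, Prod.snd_add, add_mul, map_add, h3, h6, add_mul]
  algebraMap_mem' := by
    intro c k
    rw [← Algebra.commutes, mul_assoc, ← Units.val_mul, ← zpow_add, add_neg_cancel, zpow_zero,
      Units.val_one, mul_one, Algebra.algebraMap_eq_smul_one]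
    refine ⟨?_, fun d => ?_, fun d => ?_⟩
    · simp [hΦ1]
    · simp
    · simp
  star_mem' := by
    intro v hv k
    -- The adjoint exchanges translation by `k` and by `-k`, which is why all integers occur in the
    -- carrier.
    have h : ((u ^ k : (B × A)ˣ) : B × A) * star v * ((u ^ (-k) : (B × A)ˣ) : B × A) =
        star (((u ^ (-k) : (B × A)ˣ) : B × A) * v * ((u ^ (- -k) : (B × A)ˣ) : B × A)) := by
      rw [star_mul, star_mul, ← Units.coe_star, ← Units.coe_star, star_zpow, star_zpow, hu,
        neg_neg, mul_assoc]
    obtain ⟨h1, h2, h3⟩ := hv (-k)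
    rw [h]
    refine ⟨?_, fun c => ?_, fun c => ?_⟩
    · rw [Prod.fst_star, Prod.snd_star, hΦ, h1]
    · rw [Prod.fst_star, Prod.snd_star, ← star_star (c * _), star_mul, star_star, hΦ, h3, star_mul,
        hΦ, star_star]
    · rw [Prod.fst_star, Prod.snd_star, ← star_star (_ * c), star_mul, star_star, hΦ, h2, star_mul,
        hΦ, star_star]

end Resolvents

/-! ### Block matrices over an operator algebra. -/

section Blocks

variable {n m k : ℕ} {A : Alg n} {B : Alg m}

/-- A `k × k` matrix over `A` as an operator on `ℂᵏ ⊗ ℂⁿ`. -/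
def block (a : Matrix (Fin k) (Fin k) A) : Matrix (Fin k × Fin n) (Fin k × Fin n) ℂ :=
  Matrix.comp (Fin k) (Fin k) (Fin n) (Fin n) ℂ (a.map fun x => (x : Op n))

lemma block_apply (a : Matrix (Fin k) (Fin k) A) (p q : Fin k × Fin n) :
    block a p q = (a p.1 q.1 : Op n) p.2 q.2 := rfl

lemma block_add (a b : Matrix (Fin k) (Fin k) A) : block (a + b) = block a + block b := rfl

lemma block_mul (a b : Matrix (Fin k) (Fin k) A) : block (a * b) = block a * block b := by
  ext p q
  simp only [block_apply, Matrix.mul_apply, AddSubmonoidClass.coe_finsetSum, Matrix.sum_apply,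
    MulMemClass.coe_mul, Fintype.sum_prod_type]

lemma block_star (a : Matrix (Fin k) (Fin k) A) : block (star a) = (block a).conjTranspose := rfl

lemma block_injective : Function.Injective (block : Matrix (Fin k) (Fin k) A → _) := by
  intro a b hab
  ext i j x y
  exact congrFun (congrFun hab (i, x)) (j, y)

lemma block_diagonal (c : A) : block (Matrix.diagonal fun _ : Fin k => c) =
    (1 : Matrix (Fin k) (Fin k) ℂ) ⊗ₖ (c : Op n) := by
  ext p q
  rw [block_apply, Matrix.kronecker_apply, Matrix.diagonal_apply, Matrix.one_apply]
  split_ifs <;> simp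

lemma trace_block (a : Matrix (Fin k) (Fin k) A) : (block a).trace = ∑ i, tr (a i i) := by
  simp only [Matrix.trace, Matrix.diag, block_apply, Fintype.sum_prod_type, tr_apply]

lemma block_star_mul_self_posSemidef (a : Matrix (Fin k) (Fin k) A) :
    (block (star a * a)).PosSemidef := by
  rw [block_mul, block_star]
  exact Matrix.posSemidef_conjTranspose_mul_self _

/-- The block matrices with entries in a subalgebra. -/
def blockAlg (P : StarSubalgebra ℂ A) (k : ℕ) :
    StarSubalgebra ℂ (Matrix (Fin k × Fin n) (Fin k × Fin n) ℂ) where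
  carrier := {Y | ∃ d : Matrix (Fin k) (Fin k) A, (∀ i j, d i j ∈ P) ∧ block d = Y}
  mul_mem' := by
    rintro _ _ ⟨c, hc, rfl⟩ ⟨d, hd, rfl⟩
    refine ⟨c * d, fun i j => ?_, block_mul c d⟩
    rw [Matrix.mul_apply]
    exact sum_mem fun l _ => mul_mem (hc i l) (hd l j)
  add_mem' := by
    rintro _ _ ⟨c, hc, rfl⟩ ⟨d, hd, rfl⟩
    exact ⟨c + d, fun i j => add_mem (hc i j) (hd i j), block_add c d⟩
  algebraMap_mem' := by
    intro z
    refine ⟨Matrix.diagonal fun _ => algebraMap ℂ A z, fun i j => ?_, ?_⟩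
    · rw [Matrix.diagonal_apply]
      split_ifs
      exacts [algebraMap_mem P z, zero_mem P]
    · rw [block_diagonal, Algebra.algebraMap_eq_smul_one, Algebra.algebraMap_eq_smul_one]
      change (1 : Matrix (Fin k) (Fin k) ℂ) ⊗ₖ (z • (1 : Op n)) = _
      rw [Matrix.kronecker_smul, Matrix.one_kronecker_one]
  star_mem' := by
    rintro _ ⟨c, hc, rfl⟩
    exact ⟨star c, fun i j => star_mem (hc j i), block_star c⟩

lemma star_mul_mul_apply (d X : Matrix (Fin k) (Fin k) A) (l : Fin k) :
    (star d * X * d) l l = ∑ i, ∑ j, star (d i l) * X i j * d j l := by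
  simp only [Matrix.mul_apply, Matrix.star_apply, Finset.sum_mul]
  exact Finset.sum_comm

lemma trace_diagonal_block (ρ : A) (Z : Matrix (Fin k) (Fin k) A) :
    (((1 : Matrix (Fin k) (Fin k) ℂ) ⊗ₖ (ρ : Op n)) * block Z).trace = ∑ l, tr (ρ * Z l l) := by
  rw [← block_diagonal, ← block_mul, trace_block]
  simp only [Matrix.diagonal_mul]

lemma block_posSemidef_of_nonneg (P : StarSubalgebra ℂ A) {ρ : A} (hρ : (ρ : Op n).PosDef)
    {X : Matrix (Fin k) (Fin k) A} (hX : ∀ i j, X i j ∈ P)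
    (h : ∀ d : Matrix (Fin k) (Fin k) A, (∀ i j, d i j ∈ P) →
      0 ≤ ∑ l, ∑ i, ∑ j, tr (ρ * (star (d i l) * X i j * d j l))) : (block X).PosSemidef := by
  refine posSemidef_of_trace_nonneg (blockAlg P k)
    (W := (1 : Matrix (Fin k) (Fin k) ℂ) ⊗ₖ (ρ : Op n)) (Matrix.PosDef.one.kronecker hρ)
    ⟨X, hX, rfl⟩ ?_
  rintro _ ⟨d, hd, rfl⟩
  rw [← block_star, ← block_mul, ← block_mul, trace_diagonal_block]
  simpa only [star_mul_mul_apply, Finset.mul_sum, map_sum] using h d hd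

lemma nonneg_of_block_posSemidef {ρ : A} (hρ : (ρ : Op n).PosSemidef)
    {X : Matrix (Fin k) (Fin k) A} (hX : (block X).PosSemidef) (d : Matrix (Fin k) (Fin k) A) :
    0 ≤ ∑ l, ∑ i, ∑ j, tr (ρ * (star (d i l) * X i j * d j l)) := by
  have h1 := trace_mul_nonneg (Matrix.PosSemidef.one.kronecker hρ)
    (hX.conjTranspose_mul_mul_same (block d))
  rw [← block_star, ← block_mul, ← block_mul, trace_diagonal_block] at h1
  simpa only [star_mul_mul_apply, Finset.mul_sum, map_sum] using h1

end Blocks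

/-! ### Completely positive maps and their adjoints. -/

section CompletelyPositive

variable {n m : ℕ} {A : Alg n} {B : Alg m} {Φ : A →ₗ[ℂ] B}

lemma IsCompletelyPositive.block_map (h : IsCompletelyPositive Φ) {k : ℕ}
    {a : Matrix (Fin k) (Fin k) A} (ha : (block a).PosSemidef) :
    (block (a.map Φ)).PosSemidef := h k a ha

lemma IsCompletelyPositive.map_star (h : IsCompletelyPositive Φ) (a : A) :
    Φ (star a) = star (Φ a) := by
  have h1 := h.block_map (block_star_mul_self_posSemidef (!![1, a; 0, 0] : Matrix _ _ A))
  have h2 := block_injective ((block_star _).trans h1.isHermitian)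
  have h3 := congrFun (congrFun h2 0) 1
  rw [Matrix.star_apply, Matrix.map_apply, Matrix.map_apply] at h3
  simp [Matrix.mul_apply, Fin.sum_univ_two, Matrix.star_apply] at h3
  rw [← h3, star_star]

/-- The image of the positive block matrix with rows (1, a) and (a⋆, a⋆a), compressed by the column
(−Φ(a), 1), is the Schwarz defect. -/
lemma IsCompletelyPositive.isUnitalSchwarz (h : IsCompletelyPositive Φ) (h1 : Φ 1 = 1) :
    IsUnitalSchwarz Φ := by
  refine ⟨h1, fun a => ?_⟩
  have h2 := h.block_map (block_star_mul_self_posSemidef (!![1, a; 0, 0] : Matrix _ _ A))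
  have h3 := (h2.conjTranspose_mul_mul_same
    (block (!![-Φ a, 0; 1, 0] : Matrix (Fin 2) (Fin 2) B))).submatrix
    fun i : Fin m => ((0 : Fin 2), i)
  rw [← block_star, ← block_mul, ← block_mul] at h3
  convert h3 using 1
  have h4 : Φ (star a * a) - star (Φ a) * Φ a = (star (!![-Φ a, 0; 1, 0] : Matrix _ _ B) *
      (star (!![1, a; 0, 0] : Matrix _ _ A) * !![1, a; 0, 0]).map Φ *
      (!![-Φ a, 0; 1, 0] : Matrix _ _ B)) 0 0 := by
    simp [Matrix.mul_apply, Fin.sum_univ_two, Matrix.star_apply, h1, h.map_star]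
    rw [sub_eq_neg_add]
    exact congrArg (· + _) (neg_mul (star (Φ a)) (Φ a)).symm
  rw [h4]
  rfl

lemma tr_hsAdjoint_mul (hΦ : ∀ a, Φ (star a) = star (Φ a)) (b : B) (a : A) :
    tr (hsAdjoint Φ b * a) = tr (b * Φ a) := by
  have h1 := congrArg star (hs_hsAdjoint Φ b (star a))
  rwa [hs_eq_tr, hs_eq_tr, hΦ, ← tr_star, ← tr_star, star_mul, star_mul, star_star, star_star,
    star_star, star_star, tr_mul_comm, tr_mul_comm (Φ a)] at h1

/-- Tr d⋆Φ⋆(b)d = Tr bΦ(dd⋆), read in block matrices, is the trace of a product of two positive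
matrices. -/
lemma IsCompletelyPositive.hsAdjoint (h : IsCompletelyPositive Φ) :
    IsCompletelyPositive (hsAdjoint Φ) := by
  intro k b hb
  change (block b).PosSemidef at hb
  change (block (b.map (QuantumReversibility.hsAdjoint Φ))).PosSemidef
  refine block_posSemidef_of_nonneg ⊤ (ρ := (1 : A)) Matrix.PosDef.one
    (fun _ _ => StarSubalgebra.mem_top) fun d _ => ?_
  have h1 := h.block_map (block_star_mul_self_posSemidef (star d))
  rw [star_star] at h1
  have h2 := trace_mul_nonneg hb h1
  rw [← block_mul, trace_block] at h2
  convert h2 using 1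
  rw [Finset.sum_comm]
  refine Finset.sum_congr rfl fun i _ => ?_
  rw [Matrix.mul_apply, map_sum, Finset.sum_comm]
  refine Finset.sum_congr rfl fun j _ => ?_
  simp only [Matrix.map_apply]
  rw [← tr_hsAdjoint_mul h.map_star, Matrix.mul_apply, Finset.mul_sum, map_sum]
  refine Finset.sum_congr rfl fun l _ => ?_
  rw [one_mul, mul_assoc, tr_mul_comm, Matrix.star_apply, mul_assoc]

lemma isTracePreserving_hsAdjoint (h1 : Φ 1 = 1) : IsTracePreserving (hsAdjoint Φ) := by
  intro b
  have h := hs_hsAdjoint Φ b 1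
  rw [h1, hs_eq_tr, hs_eq_tr, mul_one, mul_one, tr_star, tr_star] at h
  exact star_injective h

lemma IsTracePreserving.hsAdjoint_one (h : IsTracePreserving Φ) : hsAdjoint Φ 1 = 1 := by
  refine hs_left_injective fun a => ?_
  rw [hs_hsAdjoint, hs_eq_tr, hs_eq_tr, star_one, one_mul, star_one, one_mul]
  exact h a

lemma isUnitalSchwarz_hsAdjoint (h : IsCompletelyPositive Φ) (h1 : IsTracePreserving Φ) :
    IsUnitalSchwarz (hsAdjoint Φ) :=
  h.hsAdjoint.isUnitalSchwarz h1.hsAdjoint_one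

end CompletelyPositive

/-! ### The channel defined by a modular invariant algebra of pairs. -/

section Transfer

variable {n m : ℕ} {A : Alg n} {B : Alg m}

lemma surjective_of_injective_dual {V : Type*} [AddCommGroup V] [Module ℂ V]
    [FiniteDimensional ℂ V] (L : V →ₗ[ℂ] Module.Dual ℂ V) (h : Function.Injective L) :
    Function.Surjective L :=
  (LinearMap.injective_iff_surjective_of_finrank_eq_finrank
    (Subspace.dual_finrank_eq (K := ℂ) (V := V)).symm).1 h

/-- The orthogonal projection onto an algebra of pairs, for the inner product of a state of `B`
that agrees with a state of `A` on these pairs. -/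
lemma exists_projection (G : StarSubalgebra ℂ (B × A)) {τ : B} {ρ : A} (hτ : (τ : Op m).PosDef)
    (hρ : (ρ : Op n).PosDef) (htr : ∀ v ∈ G, tr (τ * v.1) = tr (ρ * v.2)) :
    ∃ E : B →ₗ[ℂ] B × A, (∀ b, E b ∈ G) ∧
      ∀ v ∈ G, ∀ b, tr (τ * (v.1 * (E b).1)) = tr (τ * (v.1 * b)) := by
  let V : Submodule ℂ (B × A) := Subalgebra.toSubmodule G.toSubalgebra
  let F : B →ₗ[ℂ] Module.Dual ℂ V := LinearMap.mk₂ ℂ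
    (fun (b : B) (v : V) => tr (τ * ((v : B × A).1 * b)))
    (fun _ _ _ => by simp [mul_add]) (fun _ _ _ => by simp) (fun _ _ _ => by simp [add_mul, mul_add])
    (fun _ _ _ => by simp)
  let pr : V →ₗ[ℂ] B := LinearMap.fst ℂ B A ∘ₗ V.subtype
  have hinj : Function.Injective (F ∘ₗ pr) := by
    rw [injective_iff_map_eq_zero]
    intro v hv
    have hvG : (v : B × A) ∈ G := v.2
    have h1 : tr (τ * (star (v : B × A).1 * (v : B × A).1)) = 0 :=
      LinearMap.congr_fun hv ⟨star (v : B × A), (star_mem hvG : star (v : B × A) ∈ G)⟩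
    -- Because the states agree on `G`, a pair with vanishing first coordinate has vanishing second
    -- coordinate, so the form is definite on pairs.
    have h2 : tr (ρ * (star (v : B × A).2 * (v : B × A).2)) = 0 := by
      rw [← h1]
      exact (htr _ (mul_mem (star_mem hvG) hvG)).symm
    have h3 := eq_zero_of_star_mul_self
      (eq_zero_of_tr_mul_eq_zero hτ (posSemidef_star_mul_self _) h1)
    have h4 := eq_zero_of_star_mul_self
      (eq_zero_of_tr_mul_eq_zero hρ (posSemidef_star_mul_self _) h2)
    exact Subtype.ext (Prod.ext h3 h4)
  have hsurj : Function.Surjective (F ∘ₗ pr) :=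
    surjective_of_injective_dual (V := V) (F ∘ₗ pr) hinj
  let e := LinearEquiv.ofBijective (F ∘ₗ pr) ⟨hinj, hsurj⟩
  refine ⟨V.subtype ∘ₗ e.symm.toLinearMap ∘ₗ F, fun b => (e.symm (F b)).2, fun v hv b => ?_⟩
  have h1 : (F ∘ₗ pr) (e.symm (F b)) = F b := e.apply_symm_apply (F b)
  exact LinearMap.congr_fun h1 ⟨v, hv⟩

/-- An algebra of pairs on which two faithful states agree, invariant under the modular group of
the first state, defines a channel that maps the second state to the first. -/
lemma exists_channel (G : StarSubalgebra ℂ (B × A)) {τ : Bˣ} {ρ : Aˣ}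
    (hτ : ((τ : B) : Op m).PosDef) (hρ : ((ρ : A) : Op n).PosDef)
    (htr : ∀ v ∈ G, tr ((τ : B) * v.1) = tr ((ρ : A) * v.2))
    (hG : ∀ v ∈ G, (((prodUnit τ ρ)⁻¹ : (B × A)ˣ) : B × A) * v * (prodUnit τ ρ : B × A) ∈ G) :
    ∃ Ψ : A →ₗ[ℂ] B, IsCompletelyPositive Ψ ∧ IsTracePreserving Ψ ∧
      ∀ v ∈ G, Ψ (v.2 * (ρ : A)) = v.1 * (τ : B) := by
  obtain ⟨E, hEG, hE⟩ := exists_projection G hτ hρ htr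
  let Φ : B →ₗ[ℂ] A := LinearMap.snd ℂ B A ∘ₗ E
  have hΦ : ∀ b, Φ b = (E b).2 := fun b => rfl
  -- The projection property controls only left factors from `G`. Cyclicity of the trace moves `w`
  -- to the left as τ⁻¹wτ, which is in `G` by modular invariance.
  have htr' : ∀ v ∈ G, ∀ w ∈ G, ∀ b,
      tr ((ρ : A) * (star v.2 * Φ b * w.2)) = tr ((τ : B) * (star v.1 * b * w.1)) := by
    intro v hv w hw b
    have h1 := htr _ (mul_mem (mul_mem (star_mem hv) (hEG b)) hw)
    simp only [Prod.fst_mul, Prod.snd_mul, Prod.fst_star, Prod.snd_star] at h1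
    rw [hΦ, ← h1]
    have h2 := hE _ (mul_mem (hG w hw) (star_mem hv)) b
    have h3 : ((((prodUnit τ ρ)⁻¹ : (B × A)ˣ) : B × A) * w * (prodUnit τ ρ : B × A) * star v).1 =
      ((τ⁻¹ : Bˣ) : B) * w.1 * (τ : B) * star v.1 := rfl
    rw [h3] at h2
    have h4 : ∀ c : B, tr ((τ : B) * (((τ⁻¹ : Bˣ) : B) * w.1 * (τ : B) * star v.1 * c)) =
        tr ((τ : B) * (star v.1 * c * w.1)) := by
      intro c
      simp only [mul_assoc, Units.mul_inv_cancel_left]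
      rw [tr_mul_comm]
      simp only [mul_assoc]
    rwa [h4, h4] at h2
  have hΦ1 : Φ 1 = 1 := by
    have h5 : ∀ w : B × A, w ∈ G → tr ((τ : B) * (star w.1 * w.1)) = 0 → w.2 = 0 := by
      intro w hw h0
      have h6 : tr ((ρ : A) * (star w.2 * w.2)) = 0 := by
        rw [← h0]
        exact (htr _ (mul_mem (star_mem hw) hw)).symm
      exact eq_zero_of_star_mul_self
        (eq_zero_of_tr_mul_eq_zero hρ (posSemidef_star_mul_self _) h6)
    have hw : E 1 - 1 ∈ G := sub_mem (hEG 1) (one_mem G)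
    refine sub_eq_zero.1 (h5 _ hw ?_)
    have h7 := hE _ (star_mem hw) 1
    rw [← sub_eq_zero, ← map_sub, ← mul_sub, ← mul_sub] at h7
    exact h7
  have hcp : IsCompletelyPositive Φ := by
    intro k b hb
    change (block b).PosSemidef at hb
    change (block (b.map Φ)).PosSemidef
    have hmem : ∀ a : A, a ∈ G.map (StarAlgHom.snd ℂ B A) ↔ ∃ v ∈ G, v.2 = a := fun a => Iff.rfl
    -- The values of `Φ` lie in the second projection of `G`, so it suffices to test there, where
    -- `htr'` turns the expression into one for the positive block `b`.
    refine block_posSemidef_of_nonneg (G.map (StarAlgHom.snd ℂ B A)) hρ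
      (fun i j => (hmem _).2 ⟨_, hEG (b i j), rfl⟩) fun d hd => ?_
    choose v hv hvd using fun i j => (hmem _).1 (hd i j)
    have h1 := nonneg_of_block_posSemidef hτ.posSemidef hb (Matrix.of fun i j => (v i j).1)
    convert h1 using 6 with l _ i _ j _
    rw [← hvd, ← hvd, Matrix.map_apply, htr' _ (hv i l) _ (hv j l)]
    rfl
  refine ⟨hsAdjoint Φ, hcp.hsAdjoint, isTracePreserving_hsAdjoint hΦ1, fun v hv => ?_⟩
  refine hs_left_injective fun b => ?_
  have h1 := htr' v hv 1 (one_mem G) b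
  rw [Prod.snd_one, Prod.fst_one, mul_one, mul_one] at h1
  rw [hs_hsAdjoint, hs_eq_tr, hs_eq_tr, star_mul, star_mul, star_eq_of_posSemidef hτ.posSemidef,
    star_eq_of_posSemidef hρ.posSemidef, mul_assoc, mul_assoc, h1]

end Transfer

/-! ### Channels that agree with T and invert it. -/

section Channels

variable {n m : ℕ} {A : Alg n} {B : Alg m} {T : A →ₗ[ℂ] B}

/-- The multiplicative pairs of a linear map form a subspace. -/
def multiplicativePairSubmodule (Φ : B →ₗ[ℂ] A) : Submodule ℂ (B × A) where
  carrier := {v | IsMultiplicativePair Φ v.1 v.2}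
  add_mem' := by
    rintro v w ⟨h1, h2, h3⟩ ⟨h4, h5, h6⟩
    refine ⟨?_, fun c => ?_, fun c => ?_⟩
    · rw [Prod.fst_add, Prod.snd_add, map_add, h1, h4]
    · rw [Prod.fst_add, Prod.snd_add, mul_add, map_add, h2, h5, mul_add]
    · rw [Prod.fst_add, Prod.snd_add, add_mul, map_add, h3, h6, add_mul]
  zero_mem' := by
    refine ⟨?_, fun c => ?_, fun c => ?_⟩ <;> simp
  smul_mem' := by
    rintro z v ⟨h1, h2, h3⟩
    refine ⟨?_, fun c => ?_, fun c => ?_⟩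
    · simp [h1]
    · simp [h2]
    · simp [h3]

lemma tr_mul_hsAdjoint (hT : IsUnitalSchwarz (hsAdjoint T)) (ρ : A) (b : B) :
    tr (ρ * hsAdjoint T b) = tr (T ρ * b) := by
  rw [tr_mul_comm, tr_hsAdjoint_mul (map_star_of_isUnitalSchwarz_hsAdjoint hT), tr_mul_comm]

/-- If `T` preserves the metrics for the functions `s + t` on a set `X`, then on `X` it agrees with
a channel that is inverted on `X` by another channel. -/
lemma exists_channels (hT : IsUnitalSchwarz (hsAdjoint T)) {ρ : A} (hρ : (ρ : Op n).PosDef)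
    (hτ : (T ρ : Op m).PosDef) (X : Set A) (hX : ∀ x ∈ X, star x = x)
    (h : ∀ x ∈ X, ∀ s : ℝ, 0 < s → metric (fun t => s + 1 * t) (ρ : Op n) x x =
      metric (fun t => s + 1 * t) (T ρ : Op m) (T x) (T x)) :
    ∃ (Ψ : A →ₗ[ℂ] B) (R : B →ₗ[ℂ] A), IsCompletelyPositive Ψ ∧ IsTracePreserving Ψ ∧
      IsCompletelyPositive R ∧ IsTracePreserving R ∧ Ψ ρ = T ρ ∧ R (T ρ) = ρ ∧
      ∀ x ∈ X, Ψ x = T x ∧ R (T x) = x := by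
  obtain ⟨ρ', rfl⟩ := isUnit_of_posDef hρ
  obtain ⟨τ', hτ'⟩ := isUnit_of_posDef hτ
  have hτ'' : ((τ' : B) : Op m).PosDef := hτ'.symm ▸ hτ
  have hsρ : star ρ' = ρ' := Units.ext (star_eq_of_posSemidef hρ.posSemidef)
  have hsτ : star τ' = τ' := Units.ext (star_eq_of_posSemidef hτ''.posSemidef)
  have hu : star (prodUnit τ' ρ') = prodUnit τ' ρ' :=
    Units.ext (Prod.ext (congrArg Units.val hsτ) (congrArg Units.val hsρ))
  let G := multiplicativePairs (hsAdjoint T) hT.map_star hT.1 (prodUnit τ' ρ') hu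
  have htr : ∀ v ∈ G, tr ((τ' : B) * v.1) = tr ((ρ' : A) * v.2) := by
    intro v hv
    have h1 := (hv 0).1
    simp only [zpow_zero, neg_zero, Units.val_one, one_mul, mul_one] at h1
    rw [hτ', ← tr_mul_hsAdjoint hT, h1]
  have hconj : ∀ (u : (B × A)ˣ) (v : B × A) (k l : ℤ),
      ((u ^ k : (B × A)ˣ) : B × A) * (((u ^ l : (B × A)ˣ) : B × A) * v *
        ((u ^ (-l) : (B × A)ˣ) : B × A)) * ((u ^ (-k) : (B × A)ˣ) : B × A) =
      ((u ^ (k + l) : (B × A)ˣ) : B × A) * v * ((u ^ (-(k + l)) : (B × A)ˣ) : B × A) := by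
    intro u v k l
    rw [neg_add_rev, zpow_add, zpow_add]
    simp only [Units.val_mul, mul_assoc]
  have hG : ∀ v ∈ G, (((prodUnit τ' ρ')⁻¹ : (B × A)ˣ) : B × A) * v * (prodUnit τ' ρ' : B × A)
      ∈ G := by
    intro v hv k
    have h1 := hconj (prodUnit τ' ρ') v k (-1)
    rw [neg_neg, zpow_neg_one, zpow_one] at h1
    rw [h1]
    exact hv _
  have hG' : ∀ v ∈ G, (prodUnit τ' ρ' : B × A) * v * (((prodUnit τ' ρ')⁻¹ : (B × A)ˣ) : B × A)
      ∈ G := by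
    intro v hv k
    have h1 := hconj (prodUnit τ' ρ') v k 1
    rw [zpow_neg_one, zpow_one] at h1
    rw [h1]
    exact hv _
  have hmem : ∀ x ∈ X, (T x * ((τ'⁻¹ : Bˣ) : B), x * ((ρ'⁻¹ : Aˣ) : A)) ∈ G := by
    intro x hx k
    have hTx : star (T x) = T x := by
      rw [← map_star_of_isUnitalSchwarz_hsAdjoint hT, hX x hx]
    -- Strictly positive nodes, so that both Schwarz defects vanish and the resolvents are
    -- multiplicative pairs.
    let σ : Finset ℝ := (Finset.range (n ^ 2 + m ^ 2)).image fun k : ℕ => (k : ℝ) + 1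
    have hσ : n ^ 2 + m ^ 2 ≤ σ.card := by
      rw [Finset.card_image_of_injective, Finset.card_range]
      intro a b hab
      simpa using hab
    have hσ0 : ∀ s ∈ σ, 0 < s := by
      intro s hs'
      obtain ⟨k, -, rfl⟩ := Finset.mem_image.1 hs'
      positivity
    have h1 := aeval_conjOp_mem hτ'' hρ (multiplicativePairSubmodule (hsAdjoint T)) (T x) x σ hσ
      (fun s hs' => (hσ0 s hs').le) (by
        intro s hs' b a hb ha
        rw [hτ'] at hb
        have hs0 := hσ0 s hs'
        refine isMultiplicativePair_of_hs_eq hT hs0 one_pos hρ ha hb ?_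
        rw [← metric_add_mul_self hs0.le zero_le_one (Or.inr one_pos) hρ (hX x hx) ha,
          ← metric_add_mul_self hs0.le zero_le_one (Or.inr one_pos) hτ hTx hb, h x hx s hs0])
    exact aeval_conjOp_zpow_mem _ _ h1 k
  obtain ⟨Ψ, hΨ1, hΨ2, hΨ⟩ := exists_channel G hτ'' hρ htr hG
  -- The conditions on `G` are symmetric in the two factors; the flipped algebra gives the channel
  -- in the opposite direction.
  let sw : B × A →⋆ₐ[ℂ] A × B := (StarAlgHom.snd ℂ B A).prod (StarAlgHom.fst ℂ B A)
  obtain ⟨R, hR1, hR2, hR⟩ := exists_channel (G.map sw) hρ hτ'' (by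
    rintro _ ⟨v, hv, rfl⟩
    exact (htr v hv).symm) (by
    rintro _ ⟨v, hv, rfl⟩
    exact ⟨_, hG v hv, rfl⟩)
  have hΨ' : ∀ v ∈ G, R (v.1 * (τ' : B)) = v.2 * (ρ' : A) := fun v hv => hR _ ⟨v, hv, rfl⟩
  refine ⟨Ψ, R, hΨ1, hΨ2, hR1, hR2, ?_, ?_, fun x hx => ⟨?_, ?_⟩⟩
  · have := hΨ 1 (one_mem G)
    rwa [Prod.fst_one, Prod.snd_one, one_mul, one_mul, hτ'] at this
  · have := hΨ' 1 (one_mem G)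
    rwa [Prod.fst_one, Prod.snd_one, one_mul, one_mul, hτ'] at this
  · have := hΨ _ (hmem x hx)
    rwa [Units.inv_mul_cancel_right, Units.inv_mul_cancel_right] at this
  · have := hΨ' _ (hmem x hx)
    rwa [Units.inv_mul_cancel_right, Units.inv_mul_cancel_right] at this

end Channels

/-! ### The functions s + t define monotone metrics. -/

section ResolventMetric

variable {n m : ℕ} {A : Alg n} {B : Alg m}

/-- The real part of the metric of the function `s + t`. -/
noncomputable def resolventMetric (s : ℝ) (n : ℕ) (A : Alg n) (ρ x y : A) : ℝ :=
  ((Matrix.of fun i j => ((mulSumMatrix s 1 (ρ : Op n))⁻¹.mulVec (x : Op n).vec) (j, i)) *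
    (y : Op n)).trace.re

lemma resolventMetric_eq_re_metric (s : ℝ) {ρ : A} (hρ : (ρ : Op n).PosDef) (x y : A) :
    resolventMetric s n A ρ x y = (metric (fun t => s + 1 * t) (ρ : Op n) x y).re := by
  rw [metric, JInv, J_add_mul hρ]
  rfl

lemma resolventMetric_eq {s : ℝ} (hs' : 0 < s) {ρ a x : A} (hρ : (ρ : Op n).PosDef)
    (ha : mulSum s 1 ρ a = x) (y : A) : resolventMetric s n A ρ x y = (tr (a * y)).re := by
  rw [resolventMetric_eq_re_metric s hρ,
    metric_add_mul hρ hs'.le zero_le_one (Or.inl hs') (congrArg Subtype.val ha)]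
  rfl

/-- The metric is a linear functional of the inverse of a matrix that is affine in the coordinates
and invertible at ρ. Inversion is smooth at units. -/
lemma contDiffAt_resolventMetric {s : ℝ} (hs' : 0 < s) {ρ : A} (hρ : (ρ : Op n).PosDef) (x y : A)
    {k : ℕ} (z : Fin k → A) :
    ContDiffAt ℝ ∞ (fun u : Fin k → ℝ => resolventMetric s n A (ρ + ∑ i, u i • z i) x y) 0 := by
  let : NormedRing (Matrix (Fin n × Fin n) (Fin n × Fin n) ℂ) := Matrix.linftyOpNormedRing
  let : NormedAlgebra ℝ (Matrix (Fin n × Fin n) (Fin n × Fin n) ℂ) :=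
    Matrix.linftyOpNormedAlgebra
  let ℓ : Matrix (Fin n × Fin n) (Fin n × Fin n) ℂ →ₗ[ℝ] ℝ :=
    { toFun := fun M => ((Matrix.of fun i j => (M.mulVec (x : Op n).vec) (j, i)) *
        (y : Op n)).trace.re
      map_add' := fun M N => by
        rw [← Complex.add_re, ← Matrix.trace_add, ← add_mul, Matrix.add_mulVec]
        rfl
      map_smul' := fun c M => by
        rw [Matrix.smul_mulVec, RingHom.id_apply, ← Complex.smul_re, ← Matrix.trace_smul,
          ← Matrix.smul_mul]
        rfl }
  let M : Op n →ₗ[ℝ] Matrix (Fin n × Fin n) (Fin n × Fin n) ℂ :=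
    { toFun := fun c => mulSumMatrix s 1 c
      map_add' := fun c d => by
        simp only [mulSumMatrix, rightMul, Matrix.transpose_add, Matrix.add_kronecker,
          Matrix.kronecker_add, smul_add]
        abel
      map_smul' := fun r c => by
        simp only [mulSumMatrix, rightMul, Matrix.transpose_smul, Matrix.smul_kronecker,
          Matrix.kronecker_smul, smul_add, RingHom.id_apply, smul_comm r] }
  have hM : ContDiff ℝ ∞ fun u : Fin k → ℝ => M (ρ : Op n) + ∑ i, u i • M (z i : Op n) := by
    fun_prop
  have hu : IsUnit (M (ρ : Op n)) := by
    have h1 : M (ρ : Op n) = J (fun t => s + 1 * t) (ρ : Op n) := (J_add_mul hρ s 1).symm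
    rw [h1, J]
    exact (IsUnit.of_mul_eq_one _ (cfc_mul_cfc_inv (posDef_modular hρ)
      fun t ht => by positivity)).mul (isUnit_rightMul hρ)
  have heq : (fun u : Fin k → ℝ => resolventMetric s n A (ρ + ∑ i, u i • z i) x y) =
      fun u => ℓ.toContinuousLinearMap (Ring.inverse (M (ρ : Op n) + ∑ i, u i • M (z i : Op n))) := by
    funext u
    have h1 : M (ρ : Op n) + ∑ i, u i • M (z i : Op n) =
        mulSumMatrix s 1 ((ρ + ∑ i, u i • z i : A) : Op n) := by
      have : ((ρ + ∑ i, u i • z i : A) : Op n) = (ρ : Op n) + ∑ i, u i • (z i : Op n) := by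
        simp
      rw [this]
      change _ = M _
      simp only [map_add, map_sum, map_smul]
    rw [h1, ← Matrix.nonsing_inv_eq_ringInverse]
    rfl
  rw [heq]
  refine ℓ.toContinuousLinearMap.contDiff.contDiffAt.comp _ ?_
  obtain ⟨v, hv⟩ := hu
  have h2 : M (ρ : Op n) + ∑ i, (0 : Fin k → ℝ) i • M (z i : Op n) = v := by simp [hv]
  refine ContDiffAt.comp (g := Ring.inverse) _ ?_ hM.contDiffAt
  rw [h2]
  exact contDiffAt_ringInverse ℝ v

lemma isMonotoneMetric_resolventMetric {s : ℝ} (hs' : 0 < s) :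
    IsMonotoneMetric (resolventMetric s) where
  add_left n A ρ hρ hu x y z _ _ _ := by
    have hpd := posDef_of_isUnit hρ.1 hu
    obtain ⟨a, ha⟩ := mulSum_surjective hs'.le zero_le_one (Or.inl hs') hpd x
    obtain ⟨b, hb⟩ := mulSum_surjective hs'.le zero_le_one (Or.inl hs') hpd y
    have hab : mulSum s 1 ρ (a + b) = x + y := by rw [map_add, ha, hb]
    rw [resolventMetric_eq hs' hpd hab, resolventMetric_eq hs' hpd ha, resolventMetric_eq hs' hpd hb,
      add_mul, map_add, Complex.add_re]
  smul_left n A ρ hρ hu c x y _ _ := by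
    have hpd := posDef_of_isUnit hρ.1 hu
    obtain ⟨a, ha⟩ := mulSum_surjective hs'.le zero_le_one (Or.inl hs') hpd x
    have hca : mulSum s 1 ρ ((c : ℂ) • a) = c • x := by
      rw [map_smul, ha]
      exact Complex.coe_smul c x
    rw [resolventMetric_eq hs' hpd hca, resolventMetric_eq hs' hpd ha, smul_mul_assoc, map_smul,
      smul_eq_mul, Complex.re_ofReal_mul]
  symm n A ρ hρ hu x y hx hy := by
    have hpd := posDef_of_isUnit hρ.1 hu
    have hsρ := star_eq_of_posSemidef hρ.1
    obtain ⟨a, ha⟩ := mulSum_surjective hs'.le zero_le_one (Or.inl hs') hpd x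
    obtain ⟨b, hb⟩ := mulSum_surjective hs'.le zero_le_one (Or.inl hs') hpd y
    rw [resolventMetric_eq hs' hpd ha, resolventMetric_eq hs' hpd hb]
    -- The function s + t is not symmetric, so exchanging the arguments only conjugates the value;
    -- the real part is what becomes symmetric.
    have h1 : tr (a * y) = star (tr (b * x)) := by
      have h2 : tr (a * y) = hs y a := by rw [hs_eq_tr, hy.1.star_eq, tr_mul_comm]
      have h3 : tr (b * x) = hs x b := by rw [hs_eq_tr, hx.1.star_eq, tr_mul_comm]
      rw [h2, h3, star_hs, ← ha, ← hb, hs_mulSum_left _ _ hsρ]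
    rw [h1]
    exact Complex.conj_re _
  pos n A ρ hρ hu x hx hx0 := by
    have hpd := posDef_of_isUnit hρ.1 hu
    obtain ⟨a, ha⟩ := mulSum_surjective hs'.le zero_le_one (Or.inl hs') hpd x
    rw [resolventMetric_eq_re_metric s hpd,
      metric_add_mul_self hs'.le zero_le_one (Or.inl hs') hpd hx.1.star_eq ha, ← ha]
    have h1 := hs_mulSum_self_nonneg hs'.le zero_le_one hpd.posSemidef a
    refine (Complex.pos_iff.1 (lt_of_le_of_ne h1 fun h0 => hx0 ?_)).1
    rw [← ha, eq_zero_of_hs_mulSum_self hs'.le zero_le_one (Or.inl hs') hpd h0.symm, map_zero]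
  smooth n A ρ hρ hu x y _ _ k z _ :=
    contDiffAt_resolventMetric hs' (posDef_of_isUnit hρ.1 hu) x y z
  monotone n m A B T hcp htp ρ hρ hu hTu x hx := by
    have hT := isUnitalSchwarz_hsAdjoint hcp htp
    have hpd := posDef_of_isUnit hρ.1 hu
    have hτ := posDef_of_isUnit (posSemidef_map_of_isUnitalSchwarz_hsAdjoint hT hρ.1) hTu
    rw [resolventMetric_eq_re_metric s hpd, resolventMetric_eq_re_metric s hτ]
    exact (Complex.le_def.1
      (metric_map_le hT hs'.le zero_le_one (Or.inl hs') hpd hτ hx.1.star_eq)).1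

end ResolventMetric

/-! ### The square root as a witness with infinite support. -/

section SquareRoot

lemma isOperatorMonotone_sqrt : IsOperatorMonotone Real.sqrt := by
  intro k a b ha hb hab
  have key : ∀ c : Op k, c.PosDef → ∃ r : Op k, open scoped MatrixOrder in
      r = CFC.sqrt c ∧ r = cfc Real.sqrt c := by
    open scoped MatrixOrder in
    intro c hc
    refine ⟨_, rfl, ?_⟩
    rw [CFC.sqrt_eq_real_sqrt c hc.posSemidef.nonneg, cfcₙ_eq_cfc]
  obtain ⟨r, hr, hr'⟩ := key a ha
  obtain ⟨t, ht, ht'⟩ := key b hb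
  rw [← hr', ← ht']
  open scoped MatrixOrder Matrix.Norms.L2Operator in
  rw [← Matrix.le_iff, hr, ht]
  exact CFC.sqrt_le_sqrt a b hab

lemma isSymmOperatorMonotone_sqrt : IsSymmOperatorMonotone Real.sqrt where
  pos t ht := Real.sqrt_pos.2 ht
  symm t ht := by
    rw [Real.sqrt_inv]
    have h := Real.mul_self_sqrt ht.le
    have h1 : Real.sqrt t ≠ 0 := (Real.sqrt_pos.2 ht).ne'
    field_simp
    nlinarith
  operatorMonotone := isOperatorMonotone_sqrt

open MeasureTheory in
-- The integral formula √t = C ∫ s^(−1/2) t/(s+t) ds, divided by t, represents 1/√t by the density C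
-- s^(−1/2) on (0, ∞), whose positivity puts every s > 0 in the support.
lemma exists_isRepresentingMeasure_sqrt :
    ∃ ν : Measure ℝ, IsRepresentingMeasure Real.sqrt ν ∧ ν.support.encard = ⊤ := by
  have hp : (1 / 2 : ℝ) ∈ Set.Ioo (0 : ℝ) 1 := by norm_num
  set C := (∫ t in Set.Ioi 0, Real.rpowIntegrand₀₁ (1 / 2) t 1)⁻¹ with hC
  have hCpos : 0 < C := inv_pos.2 (Real.integral_rpowIntegrand₀₁_one_pos hp)
  let w : ℝ → NNReal := fun s => Real.toNNReal (C * s ^ (-(1 / 2) : ℝ))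
  have hw : Measurable w := by
    have : Measurable fun s : ℝ => s ^ (-(1 / 2) : ℝ) := measurable_id.pow_const _
    exact (this.const_mul C).real_toNNReal
  have hwpos : ∀ s : ℝ, 0 < s → (w s : ℝ) = C * s ^ (-(1 / 2) : ℝ) := fun s hs' =>
    Real.coe_toNNReal _ (by positivity)
  let ν : Measure ℝ := (volume.restrict (Set.Ioi 0)).withDensity fun s => (w s : ENNReal)
  have hkey : ∀ t : ℝ, 0 < t → Set.EqOn (fun s => w s • (s + t)⁻¹)
      (fun s => (C * t⁻¹) * Real.rpowIntegrand₀₁ (1 / 2) s t) (Set.Ioi 0) := by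
    intro t ht s hs'
    have hs0 : (0 : ℝ) < s := hs'
    simp only [NNReal.smul_def, smul_eq_mul]
    rw [hwpos s hs0, Real.rpowIntegrand₀₁_eq_pow_div hp hs0.le ht.le]
    have : (1 / 2 - 1 : ℝ) = -(1 / 2) := by norm_num
    rw [this]
    field_simp
  refine ⟨ν, ⟨?_, 0, le_rfl, fun t ht => ⟨?_, ?_⟩⟩, ?_⟩
  · refine withDensity_absolutelyContinuous _ _ ?_
    rw [Measure.restrict_apply measurableSet_Iio]
    have : Set.Iio (0 : ℝ) ∩ Set.Ioi 0 = ∅ := by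
      ext s
      simp only [Set.mem_inter_iff, Set.mem_Iio, Set.mem_Ioi, Set.mem_empty_iff_false, iff_false]
      intro h
      linarith [h.1, h.2]
    rw [this, measure_empty]
  · rw [integrable_withDensity_iff_integrable_smul hw]
    refine (integrableOn_congr_fun (hkey t ht) measurableSet_Ioi).2 ?_
    exact (Real.integrableOn_rpowIntegrand₀₁_Ioi hp ht.le).const_mul _
  · rw [zero_add, integral_withDensity_eq_integral_smul hw,
      setIntegral_congr_fun measurableSet_Ioi (hkey t ht), integral_const_mul]
    have h1 := Real.rpow_eq_const_mul_integral hp ht.le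
    rw [← Real.sqrt_eq_rpow, ← hC] at h1
    rw [mul_assoc, mul_left_comm, ← h1]
    have h2 := Real.mul_self_sqrt ht.le
    have h3 : Real.sqrt t ≠ 0 := (Real.sqrt_pos.2 ht).ne'
    field_simp
    nlinarith
  · rw [Set.encard_eq_top_iff]
    refine (Set.Ioi_infinite (0 : ℝ)).mono fun s hs' => ?_
    have hs0 : (0 : ℝ) < s := hs'
    rw [Measure.mem_support_iff_forall]
    intro U hU
    rw [pos_iff_ne_zero]
    intro h0
    rw [withDensity_apply_eq_zero hw.coe_nnreal_ennreal] at h0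
    have h1 : U ∩ Set.Ioi 0 ⊆ {s | (w s : ENNReal) ≠ 0} ∩ U := by
      rintro r ⟨hr, hr0⟩
      refine ⟨?_, hr⟩
      have hr0' : (0 : ℝ) < r := hr0
      have h2 : (w r : ℝ) ≠ 0 := by
        rw [hwpos r hr0']
        positivity
      simpa using h2
    have h3 : volume.restrict (Set.Ioi 0) (U ∩ Set.Ioi 0) = 0 := measure_mono_null h1 h0
    rw [Measure.restrict_eq_self _ Set.inter_subset_right] at h3
    exact (Measure.measure_pos_of_mem_nhds volume
      (Filter.inter_mem hU (Ioi_mem_nhds hs0))).ne' h3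

end SquareRoot

/-! ### Reversibility and preservation of the metrics. -/

section Equivalence

variable {n m : ℕ} {A : Alg n} {B : Alg m} {T : A →ₗ[ℂ] B} {S : Set A} {ρ : A}

lemma Lin_induction {p : A → Prop} (h0 : p 0) (hadd : ∀ x y, p x → p y → p (x + y))
    (hsmul : ∀ (c : ℝ) x, p x → p (c • x)) (hS : ∀ σ₁ ∈ S, ∀ σ₂ ∈ S, p (σ₁ - σ₂)) {x : A}
    (hx : x ∈ Lin S) : p x := by
  refine Submodule.span_induction ?_ h0 (fun x y _ _ => hadd x y) (fun c x _ => hsmul c x) hx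
  rintro _ ⟨σ₁, h₁, σ₂, h₂, rfl⟩
  exact hS σ₁ h₁ σ₂ h₂

lemma isTangent_of_mem_Lin (hS : ∀ σ ∈ S, IsDensity σ) {x : A} (hx : x ∈ Lin S) :
    IsTangent x := by
  refine Lin_induction (p := IsTangent) ⟨IsSelfAdjoint.zero _, by simp⟩ ?_ ?_ ?_ hx
  · rintro x y ⟨h1, h2⟩ ⟨h3, h4⟩
    exact ⟨h1.add h3, by simp [Matrix.trace_add, h2, h4]⟩
  · rintro c x ⟨h1, h2⟩
    refine ⟨?_, ?_⟩
    · rw [← Complex.coe_smul]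
      rw [IsSelfAdjoint, star_smul, h1.star_eq, RCLike.star_def, Complex.conj_ofReal]
    · rw [← Complex.coe_smul]
      simp [Matrix.trace_smul, h2]
  · intro σ₁ h₁ σ₂ h₂
    refine ⟨?_, ?_⟩
    · rw [IsSelfAdjoint, star_sub, star_eq_of_posSemidef (hS σ₁ h₁).1,
        star_eq_of_posSemidef (hS σ₂ h₂).1]
    · simp [Matrix.trace_sub, (hS σ₁ h₁).2, (hS σ₂ h₂).2]

lemma map_real_smul (T : A →ₗ[ℂ] B) (c : ℝ) (x : A) : T (c • x) = c • T x := by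
  rw [← Complex.coe_smul, map_smul, Complex.coe_smul]

/-- A reversible map preserves the metrics for the functions `s + t`, by monotonicity for the map and
for its inverse. -/
lemma metric_eq_of_isReversible (hS : ∀ σ ∈ S, IsDensity σ) (hρS : ρ ∈ S)
    (hρ : (ρ : Op n).PosDef) (hτ : (T ρ : Op m).PosDef) (hT : IsUnitalSchwarz (hsAdjoint T))
    (h : IsReversible T S) {x : A} (hx : x ∈ Lin S) {s : ℝ} (hs' : 0 < s) :
    metric (fun t => s + 1 * t) (ρ : Op n) x x =
      metric (fun t => s + 1 * t) (T ρ : Op m) (T x) (T x) := by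
  obtain ⟨R, hR, hRT⟩ := h
  have hRx : R (T x) = x := by
    refine Lin_induction (p := fun x => R (T x) = x) (by simp) ?_ ?_ ?_ hx
    · intro x y hx hy
      rw [map_add, map_add, hx, hy]
    · intro c x hx
      rw [map_real_smul, map_real_smul, hx]
    · intro σ₁ h₁ σ₂ h₂
      rw [map_sub, map_sub, hRT σ₁ h₁, hRT σ₂ h₂]
  have hsx : star x = x := (isTangent_of_mem_Lin hS hx).1
  have hsTx : star (T x) = T x := by rw [← map_star_of_isUnitalSchwarz_hsAdjoint hT, hsx]
  refine le_antisymm ?_ (metric_map_le hT hs'.le zero_le_one (Or.inl hs') hρ hτ hsx)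
  have h1 := metric_map_le hR hs'.le zero_le_one (Or.inl hs') hτ
    (by rw [hRT ρ hρS]; exact hρ) hsTx
  rwa [hRx, hRT ρ hρS] at h1

/-- Preservation of the metrics for the functions `s + t` implies reversibility. The recovery map is
completely positive and trace preserving, so no Schwarz condition on the Petz dual of `T` is needed
here. -/
lemma isReversible_of_metric_eq (hS : ∀ σ ∈ S, IsDensity σ) (hρS : ρ ∈ S)
    (hρ : (ρ : Op n).PosDef) (hτ : (T ρ : Op m).PosDef) (hT : IsUnitalSchwarz (hsAdjoint T))
    (h : ∀ σ ∈ S, ∀ s : ℝ, 0 < s →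
      metric (fun t => s + 1 * t) (ρ : Op n) (σ - ρ : A) (σ - ρ : A) =
      metric (fun t => s + 1 * t) (T ρ : Op m) (T (σ - ρ)) (T (σ - ρ))) :
    IsReversible T S := by
  obtain ⟨Ψ, R, -, -, hR1, hR2, -, hRρ, hR⟩ := exists_channels hT hρ hτ
    ((fun σ => σ - ρ) '' S) (by
      rintro _ ⟨σ, hσ, rfl⟩
      exact (isTangent_of_mem_Lin hS (Submodule.subset_span ⟨σ, hσ, ρ, hρS, rfl⟩)).1) (by
      rintro _ ⟨σ, hσ, rfl⟩
      exact h σ hσ)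
  refine ⟨R, isUnitalSchwarz_hsAdjoint hR1 hR2, fun σ hσ => ?_⟩
  have h1 := (hR _ ⟨σ, hσ, rfl⟩).2
  rwa [map_sub, map_sub, hRρ, sub_left_inj] at h1

/-- A reversible map preserves all monotone metrics. -/
lemma monotoneMetric_eq_of_isReversible (hS : ∀ σ ∈ S, IsDensity σ) (hρS : ρ ∈ S)
    (hu : IsUnit ρ) (hTu : IsUnit (T ρ)) (hT : IsUnitalSchwarz (hsAdjoint T))
    (h : IsReversible T S) {g : ∀ (k : ℕ) (C : Alg k), C → C → C → ℝ} (hg : IsMonotoneMetric g)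
    {x : A} (hx : x ∈ Lin S) : g n A ρ x x = g m B (T ρ) (T x) (T x) := by
  have hTpos := posSemidef_map_of_isUnitalSchwarz_hsAdjoint hT (hS ρ hρS).1
  have hρ := posDef_of_isUnit (hS ρ hρS).1 hu
  have hτ := posDef_of_isUnit hTpos hTu
  -- Monotone metrics are only assumed to contract under completely positive maps, so `T` and the
  -- given recovery map, whose adjoints are merely Schwarz, are replaced by channels.
  obtain ⟨Ψ, R, hΨ1, hΨ2, hR1, hR2, hΨρ, hRρ, hΨR⟩ := exists_channels hT hρ hτ (Lin S)
    (fun y hy => (isTangent_of_mem_Lin hS hy).1)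
    fun y hy s hs' => metric_eq_of_isReversible hS hρS hρ hτ hT h hy hs'
  have hxt := isTangent_of_mem_Lin hS hx
  obtain ⟨hΨx, hRx⟩ := hΨR x hx
  refine le_antisymm ?_ ?_
  · have h1 := hg.monotone m n B A R hR1 hR2 (T ρ)
      ⟨hTpos, (tr_map_of_isUnitalSchwarz_hsAdjoint hT ρ).trans (hS ρ hρS).2⟩ hTu
      (by rw [hRρ]; exact hu) (T x)
      ⟨(map_star_of_isUnitalSchwarz_hsAdjoint hT x).symm.trans (congrArg T hxt.1),
        (tr_map_of_isUnitalSchwarz_hsAdjoint hT x).trans hxt.2⟩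
    rwa [hRρ, hRx] at h1
  · have h1 := hg.monotone n m A B Ψ hΨ1 hΨ2 ρ (hS ρ hρS) hu (by rw [hΨρ]; exact hTu) x hxt
    rwa [hΨρ, hΨx] at h1

end Equivalence

end QuantumReversibility

open QuantumReversibility
theorem theorem7 {n m : ℕ} (A : Alg n) (B : Alg m) (T : A →ₗ[ℂ] B) (S : Set A)
    (hS : ∀ σ ∈ S, IsDensity σ) (ρ : A) (hρS : ρ ∈ S) (hρ : IsUnit ρ) (hTρ : IsUnit (T ρ))
    (hT : IsUnitalSchwarz (hsAdjoint T)) (hTdual : IsUnitalSchwarz (petzDual T ρ)) :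
    List.TFAE [
      IsReversible T S,
      ∀ g : (∀ (k : ℕ) (C : Alg k), C → C → C → ℝ), IsMonotoneMetric g →
        ∀ x ∈ Lin S, g n A ρ x x = g m B (T ρ) (T x) (T x),
      ∀ f : ℝ → ℝ, IsSymmOperatorMonotone f →
        ∀ x ∈ Lin S, metric f (ρ : Op n) x x = metric f (T ρ : Op m) (T x) (T x),
      ∀ f : ℝ → ℝ, IsSymmOperatorMonotone f →
        ∀ σ ∈ S, chiSq f (σ : Op n) ρ = chiSq f (T σ : Op m) (T ρ),
      ∃ f : ℝ → ℝ, IsSymmOperatorMonotone f ∧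
        (∃ ν : MeasureTheory.Measure ℝ, IsRepresentingMeasure f ν ∧
          ((n ^ 2 + m ^ 2 : ℕ) : ℕ∞) ≤ ν.support.encard) ∧
        ∀ x ∈ Lin S, metric f (ρ : Op n) x x = metric f (T ρ : Op m) (T x) (T x),
      ∃ f : ℝ → ℝ, IsSymmOperatorMonotone f ∧
        (∃ ν : MeasureTheory.Measure ℝ, IsRepresentingMeasure f ν ∧
          ((n ^ 2 + m ^ 2 : ℕ) : ℕ∞) ≤ ν.support.encard) ∧
        ∀ σ ∈ S, chiSq f (σ : Op n) ρ = chiSq f (T σ : Op m) (T ρ)] := by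
  have hpd := posDef_of_isUnit (hS ρ hρS).1 hρ
  have hτ := posDef_of_isUnit (posSemidef_map_of_isUnitalSchwarz_hsAdjoint hT (hS ρ hρS).1) hTρ
  have hLin : ∀ σ ∈ S, σ - ρ ∈ Lin S := fun σ hσ => Submodule.subset_span ⟨σ, hσ, ρ, hρS, rfl⟩
  have hself : ∀ σ ∈ S, star (σ - ρ) = σ - ρ := fun σ hσ =>
    (isTangent_of_mem_Lin hS (hLin σ hσ)).1
  have hchi : ∀ (f : ℝ → ℝ) (σ : A),
      (chiSq f (σ : Op n) ρ = chiSq f (T σ : Op m) (T ρ) ↔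
        metric f (ρ : Op n) (σ - ρ : A) (σ - ρ : A) =
          metric f (T ρ : Op m) (T (σ - ρ)) (T (σ - ρ))) := by
    intro f σ
    rw [map_sub]
    rfl
  obtain ⟨ν₀, hν₀, hν₀'⟩ := exists_isRepresentingMeasure_sqrt
  have hsupp : ((n ^ 2 + m ^ 2 : ℕ) : ℕ∞) ≤ ν₀.support.encard := by
    rw [hν₀']
    exact le_top
  tfae_have 1 → 2 := fun h g hg x hx => monotoneMetric_eq_of_isReversible hS hρS hρ hTρ hT h hg hx
  tfae_have 2 → 1 := by
    intro h
    refine isReversible_of_metric_eq hS hρS hpd hτ hT fun σ hσ s hs' => ?_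
    have h1 := h _ (isMonotoneMetric_resolventMetric hs') _ (hLin σ hσ)
    rw [resolventMetric_eq_re_metric s hpd, resolventMetric_eq_re_metric s hτ] at h1
    have hsT : star (T (σ - ρ)) = T (σ - ρ) := by
      rw [← map_star_of_isUnitalSchwarz_hsAdjoint hT, hself σ hσ]
    -- The resolvent metric records only real parts; nonnegativity makes the imaginary parts vanish.
    have h2 := metric_add_mul_self_nonneg hs'.le zero_le_one (Or.inl hs') hpd (hself σ hσ)
    have h3 := metric_add_mul_self_nonneg hs'.le zero_le_one (Or.inl hs') hτ hsT
    exact Complex.ext h1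
      ((Complex.nonneg_iff.1 h2).2.symm.trans (Complex.nonneg_iff.1 h3).2)
  tfae_have 1 → 3 := fun h f hf x hx => metric_eq_of_forall_add_mul_eq hpd hτ
    (fun s hs' => metric_eq_of_isReversible hS hρS hpd hτ hT h hx hs') hf.pos
  tfae_have 3 → 4 := fun h f hf σ hσ => (hchi f σ).2 (h f hf _ (hLin σ hσ))
  tfae_have 3 → 5 := fun h => ⟨Real.sqrt, isSymmOperatorMonotone_sqrt, ⟨ν₀, hν₀, hsupp⟩,
    h _ isSymmOperatorMonotone_sqrt⟩
  tfae_have 4 → 6 := fun h => ⟨Real.sqrt, isSymmOperatorMonotone_sqrt, ⟨ν₀, hν₀, hsupp⟩,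
    h _ isSymmOperatorMonotone_sqrt⟩
  tfae_have 5 → 6 := fun ⟨f, hf, hν, h⟩ => ⟨f, hf, hν, fun σ hσ => (hchi f σ).2 (h _ (hLin σ hσ))⟩
  tfae_have 6 → 1 := by
    rintro ⟨f, hf, ⟨ν, hν, hcard⟩, h⟩
    -- The support may be infinite; exactly n² + m² of its points are kept to obtain a finite set of
    -- nodes.
    obtain ⟨t, ht, htcard⟩ := Set.exists_subset_encard_eq hcard
    have hfin : t.Finite := Set.finite_of_encard_eq_coe htcard
    have hmem : ∀ s ∈ hfin.toFinset, s ∈ ν.support := fun s hs' => ht (hfin.mem_toFinset.1 hs')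
    have hσcard : n ^ 2 + m ^ 2 ≤ hfin.toFinset.card := by
      rw [hfin.encard_eq_coe_toFinset_card] at htcard
      exact (by exact_mod_cast htcard.symm : n ^ 2 + m ^ 2 = hfin.toFinset.card).le
    refine isReversible_of_metric_eq hS hρS hpd hτ hT fun σ hσ s hs' => ?_
    have hsup := fun s (hs' : s ∈ hfin.toFinset) => metric_eq_of_mem_support hT hpd hτ
      (hself σ hσ) hf.pos hν ((hchi f σ).1 (h σ hσ)) (hmem s hs')
    exact metric_eq_of_finset hT hpd hτ (hself σ hσ) hfin.toFinset hσcard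
      (fun s hs' => (hsup s hs').1) (fun s hs' => (hsup s hs').2) hs'
  tfae_finish
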